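/- Let $\Omega\subset\mathbb{R}^4$ be a bounded open set, and let $H^2_0(\Omega)$ be the closure of $C_c^\infty(\Omega)$ in the (real) Sobolev space $H^2(\Omega)=W^{2,2}(\Omega)$. For a measurable function $f$ on $\Omega$ that is finite a.e., let $f^*(t)=\inf\{s>0: |\{x\in\Omega: |f(x)|>s\}|<t\}$ ($t>0$) be its decreasing rearrangement, let $f^{**}(t)=\frac1t\int_0^t f^*(\tau)\,d\tau$, and put $$|f|_{(\infty,2,-1)}=\left(\int_0^{|\Omega|}\left(\frac{f^*(t)}{\log(e|\Omega|/t)}\right)^2\frac{dt}{t}\right)^{1/2},\qquad \|f\|_{(\infty,2,-1)}=\left(\int_0^{|\Omega|}\left(\frac{f^{**}(t)}{\log(e|\Omega|/t)}\right)^2\frac{dt}{t}\right)^{1/2}.$$ The Lorentz–Zygmund space $L^{\infty,2}(\log L)^{-1}(\Omega)$ consists of the $f$ with $|f|_{(\infty,2,-1)}<\infty$ and is normed by $\|\cdot\|_{(\infty,2,-1)}$. Then $H^2_0(\Omega)$ embeds continuously into $L^{\infty,2}(\log L)^{-1}(\Omega)$. That is, there is a constant $C=C(\Omega)$ such that every $u\in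 H^2_0(\Omega)$ belongs to $L^{\infty,2}(\log L)^{-1}(\Omega)$ and satisfies $$|u|_{(\infty,2,-1)}\le C\,\|\Delta u\|_{L^2(\Omega)},\qquad \|u\|_{(\infty,2,-1)}\le C\,\|\Delta u\|_{L^2(\Omega)}\qquad\text{and}\qquad \|u\|_{(\infty,2,-1)}\le C\,\|u\|_{H^2(\Omega)}.$$ -/

import Mathlib

open MeasureTheory TopologicalSpace
open scoped ENNReal NNReal Distributions

namespace LorentzZygmund

noncomputable section

/-! ### The Sobolev space `H²₀(Ω)`

Functions on `Ω` are represented by functions on the whole space whose values outside `Ω` play no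
role, and, as usual, functions that agree almost everywhere on `Ω` are not distinguished. -/

/-- `v` is the weak partial derivative `∂ᵢ u` on the open set `Ω`: both functions are locally
integrable on `Ω`, and `∫_Ω u ∂ᵢφ = - ∫_Ω v φ` for every test function `φ ∈ C_c^∞(Ω)`. -/
def IsWeakPartial {N : ℕ} (Ω : Opens (EuclideanSpace ℝ (Fin N))) (i : Fin N)
    (u v : EuclideanSpace ℝ (Fin N) → ℝ) : Prop :=
  LocallyIntegrableOn u (Ω : Set (EuclideanSpace ℝ (Fin N))) ∧
  LocallyIntegrableOn v (Ω : Set (EuclideanSpace ℝ (Fin N))) ∧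
  ∀ φ : 𝓓(Ω, ℝ),
    ∫ x in (Ω : Set (EuclideanSpace ℝ (Fin N))),
        u x * lineDeriv ℝ φ x (EuclideanSpace.single i (1 : ℝ)) =
      - ∫ x in (Ω : Set (EuclideanSpace ℝ (Fin N))), v x * φ x

open Classical in
/-- The weak partial derivative `∂ᵢ u` on `Ω` (unique up to a null set), and `0` if there is
none. -/
def weakPartial {N : ℕ} (Ω : Opens (EuclideanSpace ℝ (Fin N))) (i : Fin N)
    (u : EuclideanSpace ℝ (Fin N) → ℝ) : EuclideanSpace ℝ (Fin N) → ℝ :=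
  if h : ∃ v, IsWeakPartial Ω i u v then h.choose else 0

/-- The weak Laplacian `Δu = ∑ᵢ ∂ᵢ∂ᵢ u` on `Ω`. -/
def weakLaplacian {N : ℕ} (Ω : Opens (EuclideanSpace ℝ (Fin N)))
    (u : EuclideanSpace ℝ (Fin N) → ℝ) : EuclideanSpace ℝ (Fin N) → ℝ :=
  fun x => ∑ i, weakPartial Ω i (weakPartial Ω i u) x

/-- The norm of `L²(Ω)`. -/
def l2Norm {N : ℕ} (Ω : Opens (EuclideanSpace ℝ (Fin N)))
    (u : EuclideanSpace ℝ (Fin N) → ℝ) : ℝ≥0∞ :=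
  eLpNorm u 2 (volume.restrict (Ω : Set (EuclideanSpace ℝ (Fin N))))

/-- Membership in the Sobolev space `H²(Ω) = W^{2,2}(Ω)`: the function is in `L²(Ω)` and its weak
partial derivatives of orders one and two exist and are in `L²(Ω)`. -/
structure MemH2 {N : ℕ} (Ω : Opens (EuclideanSpace ℝ (Fin N)))
    (u : EuclideanSpace ℝ (Fin N) → ℝ) : Prop where
  memLp : MemLp u 2 (volume.restrict (Ω : Set (EuclideanSpace ℝ (Fin N))))
  exists_first : ∀ i, ∃ v, IsWeakPartial Ω i u v
  memLp_first : ∀ i, MemLp (weakPartial Ω i u) 2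
    (volume.restrict (Ω : Set (EuclideanSpace ℝ (Fin N))))
  exists_second : ∀ i j, ∃ v, IsWeakPartial Ω j (weakPartial Ω i u) v
  memLp_second : ∀ i j, MemLp (weakPartial Ω j (weakPartial Ω i u)) 2
    (volume.restrict (Ω : Set (EuclideanSpace ℝ (Fin N))))

/-- The norm of `H²(Ω)`: the square root of the sum of the squared `L²(Ω)` norms of the function
and of its weak partial derivatives of orders one and two. -/
def h2Norm {N : ℕ} (Ω : Opens (EuclideanSpace ℝ (Fin N)))
    (u : EuclideanSpace ℝ (Fin N) → ℝ) : ℝ≥0∞ :=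
  (l2Norm Ω u ^ 2 + ∑ i, l2Norm Ω (weakPartial Ω i u) ^ 2 +
    ∑ i, ∑ j, l2Norm Ω (weakPartial Ω j (weakPartial Ω i u)) ^ 2) ^ (1 / 2 : ℝ)

/-- Membership in `H²₀(Ω)`, the closure of `C_c^∞(Ω)` in `H²(Ω)`. -/
def MemH20 {N : ℕ} (Ω : Opens (EuclideanSpace ℝ (Fin N)))
    (u : EuclideanSpace ℝ (Fin N) → ℝ) : Prop :=
  MemH2 Ω u ∧ ∀ ε : ℝ≥0∞, 0 < ε → ∃ φ : 𝓓(Ω, ℝ), h2Norm Ω (fun x => u x - φ x) < ε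

/-! ### Rearrangements and Lorentz–Zygmund spaces -/

/-- The distribution function `s ↦ |{x ∈ Ω : |f x| > s}|`. -/
def distribFun {N : ℕ} (Ω : Opens (EuclideanSpace ℝ (Fin N)))
    (f : EuclideanSpace ℝ (Fin N) → ℝ) (s : ℝ≥0∞) : ℝ≥0∞ :=
  volume {x | x ∈ Ω ∧ s < ‖f x‖ₑ}

/-- The decreasing rearrangement `f*` on `[0, ∞)`: the essential supremum of `|f|` at `t = 0`, and
`f*(t) = inf {s > 0 : |{|f| > s}| < t}` for `t > 0`. -/
def rearr {N : ℕ} (Ω : Opens (EuclideanSpace ℝ (Fin N)))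
    (f : EuclideanSpace ℝ (Fin N) → ℝ) (t : ℝ) : ℝ≥0∞ :=
  if t = 0 then
    essSup (fun x => ‖f x‖ₑ) (volume.restrict (Ω : Set (EuclideanSpace ℝ (Fin N))))
  else sInf {s : ℝ≥0∞ | 0 < s ∧ distribFun Ω f s < ENNReal.ofReal t}

/-- The maximal function `f**(t) = (1/t) ∫₀ᵗ f*(τ) dτ`, for `t > 0`. -/
def maxRearr {N : ℕ} (Ω : Opens (EuclideanSpace ℝ (Fin N)))
    (f : EuclideanSpace ℝ (Fin N) → ℝ) (t : ℝ) : ℝ≥0∞ :=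
  (∫⁻ τ in Set.Ioo 0 t, rearr Ω f τ) / ENNReal.ofReal t

/-- The weight `(log (e|Ω|/t))^α t^{1/p - 1/q}` on `(0, |Ω|)`, with `1/∞ = 0`. -/
def lzWeight {N : ℕ} (Ω : Opens (EuclideanSpace ℝ (Fin N))) (p q : ℝ≥0∞) (α : ℝ) (t : ℝ) : ℝ≥0∞ :=
  ENNReal.ofReal
    (Real.log (Real.exp 1 * (volume (Ω : Set (EuclideanSpace ℝ (Fin N)))).toReal / t) ^ α *
      t ^ ((p⁻¹).toReal - (q⁻¹).toReal))

/-- The Lorentz–Zygmund quasinorm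
`|f|_{(p,q,α)} = ‖(log (e|Ω|/t))^α t^{1/p - 1/q} f*(t)‖_{L^q((0,|Ω|))}`. -/
def lzQuasinorm {N : ℕ} (Ω : Opens (EuclideanSpace ℝ (Fin N))) (p q : ℝ≥0∞) (α : ℝ)
    (f : EuclideanSpace ℝ (Fin N) → ℝ) : ℝ≥0∞ :=
  eLpNorm (fun t : ℝ => lzWeight Ω p q α t * rearr Ω f t) q
    (volume.restrict (Set.Ioo 0 (volume (Ω : Set (EuclideanSpace ℝ (Fin N)))).toReal))

/-- The Lorentz–Zygmund norm (for `p > 1`)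
`‖f‖_{(p,q,α)} = ‖(log (e|Ω|/t))^α t^{1/p - 1/q} f**(t)‖_{L^q((0,|Ω|))}`. -/
def lzNorm {N : ℕ} (Ω : Opens (EuclideanSpace ℝ (Fin N))) (p q : ℝ≥0∞) (α : ℝ)
    (f : EuclideanSpace ℝ (Fin N) → ℝ) : ℝ≥0∞ :=
  eLpNorm (fun t : ℝ => lzWeight Ω p q α t * maxRearr Ω f t) q
    (volume.restrict (Set.Ioo 0 (volume (Ω : Set (EuclideanSpace ℝ (Fin N)))).toReal))

/-- Membership in the Lorentz–Zygmund space `L^{p,q}(log L)^α(Ω)` of a bounded open set `Ω`: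
Lebesgue measurable functions on `Ω` with finite quasinorm. -/
def MemLorentzZygmund {N : ℕ} (Ω : Opens (EuclideanSpace ℝ (Fin N))) (p q : ℝ≥0∞) (α : ℝ)
    (f : EuclideanSpace ℝ (Fin N) → ℝ) : Prop :=
  AEMeasurable f (volume.restrict (Ω : Set (EuclideanSpace ℝ (Fin N)))) ∧
    lzQuasinorm Ω p q α f < ∞

end

end LorentzZygmund

/-!
Integrating twice along rays gives `φ(x) = ∫₀^∞ r (∂_v ∂_v φ)(x + r v) dr` for a test function `φ`,
and averaging over `v` in the unit ball bounds `|φ|` by the Riesz potential of order `2` of `|D²φ|`.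
In dimension `4`, O'Neil's rearrangement argument turns this into
`φ*(t) ≲ t^(-1/2) ∫₀ᵗ |D²φ|* + ∫_t^{|Ω|} τ^(-1/2) |D²φ|*(τ) dτ`. Against the weight of the
Lorentz–Zygmund norm both terms are controlled by Hardy's inequality in `L²`, the second one after
the substitution `s = log (e |Ω| / t)`, so that the quasinorm of `φ` is at most a constant times
`‖D²φ‖₂ = ‖Δφ‖₂`. Since rearrangements satisfy a Fatou inequality, the bound passes to `H²₀(Ω)` by
density. Replacing `φ*` by `φ**` costs one more application of Hardy's inequality, because the
weight at `t` is at most twice the weight at any `τ < t`.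
-/

namespace LorentzZygmund

open Set Filter Topology

section MeasureTheoryLemmas

variable {α β : Type*} [MeasurableSpace α] [MeasurableSpace β] {μ : Measure α} {ν : Measure β}

theorem lintegral_mul_setLIntegral_section_swap [SFinite μ] [SFinite ν] {S : Set (α × β)}
    (hS : MeasurableSet S) {k : α → ℝ≥0∞} {F : β → ℝ≥0∞} (hk : AEMeasurable k μ)
    (hF : AEMeasurable F ν) :
    ∫⁻ x, k x * ∫⁻ y in {y | (x, y) ∈ S}, F y ∂ν ∂μ =
      ∫⁻ y, F y * ∫⁻ x in {x | (x, y) ∈ S}, k x ∂μ ∂ν := by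
  have hSx (x : α) : MeasurableSet {y | (x, y) ∈ S} := measurable_prodMk_left hS
  have hSy (y : β) : MeasurableSet {x | (x, y) ∈ S} := measurable_prodMk_right hS
  have hswap := lintegral_lintegral_swap (μ := μ) (ν := ν)
    (f := fun x y => S.indicator (fun p : α × β => k p.1 * F p.2) (x, y))
    ((hk.comp_fst.mul hF.comp_snd).indicator hS)
  convert hswap using 3 with x y
  · rw [← lintegral_indicator (hSx x), ← lintegral_const_mul'' _ (hF.indicator (hSx x))]
    refine lintegral_congr fun y => ?_
    by_cases h : (x, y) ∈ S <;> simp [h]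
  · rw [← lintegral_indicator (hSy y), ← lintegral_const_mul'' _ (hk.indicator (hSy y))]
    refine lintegral_congr fun x => ?_
    by_cases h : (x, y) ∈ S <;> simp [h, mul_comm]

theorem volume_setOf_pos_ofReal_lt (a : ℝ≥0∞) :
    volume ({s : ℝ | ENNReal.ofReal s < a} ∩ Ioi 0) = a := by
  rcases eq_or_ne a ∞ with rfl | ha
  · simp
  · have : {s : ℝ | ENNReal.ofReal s < a} ∩ Ioi 0 = Ioo 0 a.toReal := by
      ext s
      simp only [mem_inter_iff, mem_ofPred_eq, mem_Ioi, mem_Ioo, and_comm (a := 0 < s)]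
      exact and_congr_left fun hs => ENNReal.ofReal_lt_iff_lt_toReal hs.le ha
    rw [this, Real.volume_Ioo, sub_zero, ENNReal.ofReal_toReal ha]

theorem lintegral_eq_lintegral_meas_ofReal_lt [SFinite μ] {F : α → ℝ≥0∞} (hF : AEMeasurable F μ) :
    ∫⁻ x, F x ∂μ = ∫⁻ s in Ioi (0 : ℝ), μ {x | ENNReal.ofReal s < F x} := by
  wlog hFm : Measurable F generalizing F
  · rw [lintegral_congr_ae hF.ae_eq_mk,
      this hF.measurable_mk.aemeasurable hF.measurable_mk]
    refine lintegral_congr fun s => measure_congr ?_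
    filter_upwards [hF.ae_eq_mk] with x hx
    exact congrArg (ENNReal.ofReal s < ·) hx.symm
  have hS : MeasurableSet {p : α × ℝ | ENNReal.ofReal p.2 < F p.1} :=
    measurableSet_lt (by fun_prop) (by fun_prop)
  have htonelli := lintegral_mul_setLIntegral_section_swap (μ := μ)
    (ν := volume.restrict (Ioi (0 : ℝ))) hS
    (aemeasurable_const (b := 1)) (aemeasurable_const (b := 1))
  simpa only [mem_ofPred_eq, setLIntegral_one, one_mul,
    Measure.restrict_apply' measurableSet_Ioi, volume_setOf_pos_ofReal_lt] using htonelli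

theorem lintegral_comp_eq_of_meas_lt_eq [SFinite μ] [SFinite ν] {F : α → ℝ≥0∞} {H : β → ℝ≥0∞}
    (hF : AEMeasurable F μ) (hH : AEMeasurable H ν)
    (h : ∀ a, μ {x | a < F x} = ν {y | a < H y}) {Φ : ℝ≥0∞ → ℝ≥0∞} (hΦ : Monotone Φ)
    (hΦc : Continuous Φ) (hΦ0 : Φ 0 = 0) : ∫⁻ x, Φ (F x) ∂μ = ∫⁻ y, Φ (H y) ∂ν := by
  rw [lintegral_eq_lintegral_meas_ofReal_lt (F := fun x => Φ (F x)) (by fun_prop),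
    lintegral_eq_lintegral_meas_ofReal_lt (F := fun y => Φ (H y)) (by fun_prop)]
  refine lintegral_congr fun s => ?_
  set b := sSup {a | Φ a ≤ ENNReal.ofReal s}
  have hb : Φ b ≤ ENNReal.ofReal s :=
    (isClosed_le hΦc continuous_const).csSup_mem ⟨0, by simp [hΦ0]⟩ (OrderTop.bddAbove _)
  have hlt (a : ℝ≥0∞) : ENNReal.ofReal s < Φ a ↔ b < a := by
    rw [← not_iff_not, not_lt, not_lt]
    exact ⟨fun ha => le_sSup ha, fun ha => (hΦ ha).trans hb⟩
  simp only [hlt, h]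

theorem eLpNorm_two_eq (F : α → ℝ≥0∞) : eLpNorm F 2 μ = (∫⁻ x, F x ^ 2 ∂μ) ^ (1 / 2 : ℝ) := by
  simp [eLpNorm_eq_lintegral_rpow_enorm_toReal]

theorem eLpNorm_le_liminf_of_ae_le_liminf {q : ℝ≥0∞} (hq₀ : q ≠ 0) (hq : q ≠ ∞)
    {f : α → ℝ≥0∞} {F : ℕ → α → ℝ≥0∞} (hF : ∀ n, AEMeasurable (F n) μ)
    (h : ∀ᵐ x ∂μ, f x ≤ liminf (fun n => F n x) atTop) :
    eLpNorm f q μ ≤ liminf (fun n => eLpNorm (F n) q μ) atTop := by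
  have hq' : 0 < q.toReal := ENNReal.toReal_pos hq₀ hq
  have map_liminf (r : ℝ) (hr : 0 < r) (u : ℕ → ℝ≥0∞) :
      liminf u atTop ^ r = liminf (fun n => u n ^ r) atTop :=
    (ENNReal.monotone_rpow_of_nonneg hr.le).map_liminf_of_continuousAt u
      ENNReal.continuous_rpow_const.continuousAt
  simp only [eLpNorm_eq_lintegral_rpow_enorm_toReal hq₀ hq, enorm_eq_self]
  rw [← map_liminf _ (by positivity)]
  gcongr
  calc ∫⁻ x, f x ^ q.toReal ∂μ
      ≤ ∫⁻ x, liminf (fun n => F n x ^ q.toReal) atTop ∂μ := by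
        refine lintegral_mono_ae ?_
        filter_upwards [h] with x hx
        rw [← map_liminf _ hq']
        gcongr
    _ ≤ _ := lintegral_liminf_le' fun n => (hF n).pow_const _

end MeasureTheoryLemmas

section Rearrangement

variable {N : ℕ} {Ω : Opens (EuclideanSpace ℝ (Fin N))} {f g : EuclideanSpace ℝ (Fin N) → ℝ}
  {t : ℝ} {a : ℝ≥0∞}

theorem restrict_setOf_lt_enorm (Ω : Opens (EuclideanSpace ℝ (Fin N)))
    (f : EuclideanSpace ℝ (Fin N) → ℝ) (a : ℝ≥0∞) :
    volume.restrict (Ω : Set _) {x | a < ‖f x‖ₑ} = distribFun Ω f a := by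
  rw [Measure.restrict_apply' Ω.isOpen.measurableSet, inter_comm]
  rfl

theorem measurable_lzWeight (Ω : Opens (EuclideanSpace ℝ (Fin N))) (p q : ℝ≥0∞) (α : ℝ) :
    Measurable (lzWeight Ω p q α) := by
  unfold lzWeight
  fun_prop

theorem distribFun_antitone : Antitone (distribFun Ω f) := fun _ _ h =>
  measure_mono fun _ hx => ⟨hx.1, h.trans_lt hx.2⟩

theorem rearr_of_pos (ht : 0 < t) :
    rearr Ω f t = sInf {a | 0 < a ∧ distribFun Ω f a < ENNReal.ofReal t} :=
  if_neg ht.ne'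

theorem rearr_of_neg (ht : t < 0) : rearr Ω f t = ∞ := by
  simp [rearr, ht.ne, ENNReal.ofReal_of_nonpos ht.le]

theorem distribFun_lt_of_rearr_lt (ht : 0 < t) (h : rearr Ω f t < a) :
    distribFun Ω f a < ENNReal.ofReal t := by
  rw [rearr_of_pos ht, sInf_lt_iff] at h
  obtain ⟨b, hb, hba⟩ := h
  exact (distribFun_antitone hba.le).trans_lt hb.2

theorem rearr_le_of_distribFun_lt (ht : 0 < t) (h : distribFun Ω f a < ENNReal.ofReal t) :
    rearr Ω f t ≤ a := by
  rw [rearr_of_pos ht]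
  refine le_of_forall_gt_imp_ge_of_dense fun b hb => sInf_le ⟨bot_lt_of_lt hb, ?_⟩
  exact (distribFun_antitone hb.le).trans_lt h

theorem distribFun_rearr_le (ht : 0 < t) : distribFun Ω f (rearr Ω f t) ≤ ENNReal.ofReal t := by
  rcases eq_top_or_lt_top (rearr Ω f t) with htop | htop
  · simp [htop, distribFun]
  obtain ⟨b, hb_anti, hb_mem, hb_lim⟩ := exists_seq_strictAnti_tendsto' htop
  have hmono : Monotone fun n => {x | x ∈ Ω ∧ b n < ‖f x‖ₑ} := fun m n hmn x hx =>
    ⟨hx.1, (hb_anti.antitone hmn).trans_lt hx.2⟩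
  have hU : {x | x ∈ Ω ∧ rearr Ω f t < ‖f x‖ₑ} ⊆ ⋃ n, {x | x ∈ Ω ∧ b n < ‖f x‖ₑ} :=
    fun x hx => mem_iUnion.2 <|
      (hb_lim.eventually (gt_mem_nhds hx.2)).exists.imp fun _ hn => ⟨hx.1, hn⟩
  refine (measure_mono hU).trans ?_
  rw [hmono.measure_iUnion]
  exact iSup_le fun n => (distribFun_lt_of_rearr_lt ht (hb_mem n).1).le

theorem lt_rearr_of_ofReal_lt_distribFun (ht : 0 < t) (h : ENNReal.ofReal t < distribFun Ω f a) :
    a < rearr Ω f t := by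
  by_contra! hle
  exact ((distribFun_antitone hle).trans (distribFun_rearr_le ht)).not_gt h

theorem rearr_antitone : Antitone (rearr Ω f) := by
  have hpos {s t : ℝ} (hs : 0 < s) (hst : s ≤ t) : rearr Ω f t ≤ rearr Ω f s := by
    rw [rearr_of_pos hs, rearr_of_pos (hs.trans_le hst)]
    exact sInf_le_sInf fun a ha => ⟨ha.1, ha.2.trans_le (ENNReal.ofReal_le_ofReal hst)⟩
  intro s t hst
  rcases lt_trichotomy s 0 with hs | rfl | hs
  · simp [rearr_of_neg hs]
  · rcases hst.eq_or_lt with rfl | ht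
    · rfl
    · refine rearr_le_of_distribFun_lt ht ?_
      rw [← restrict_setOf_lt_enorm, rearr, if_pos rfl, meas_essSup_lt]
      simpa
  · exact hpos hs hst

theorem measurable_rearr : Measurable (rearr Ω f) :=
  rearr_antitone.measurable

theorem rearr_eq_zero (ht : volume (Ω : Set (EuclideanSpace ℝ (Fin N))) < ENNReal.ofReal t) :
    rearr Ω f t = 0 :=
  nonpos_iff_eq_zero.1 <| rearr_le_of_distribFun_lt (ENNReal.ofReal_pos.1 (bot_lt_of_lt ht)) <|
    (measure_mono fun _ hx => hx.1).trans_lt ht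

theorem restrict_Ioi_setOf_lt_rearr (a : ℝ≥0∞) :
    volume.restrict (Ioi 0) {t | a < rearr Ω f t} = distribFun Ω f a := by
  rw [Measure.restrict_apply' measurableSet_Ioi]
  conv_rhs => rw [← volume_setOf_pos_ofReal_lt (distribFun Ω f a)]
  refine le_antisymm ?_
    (measure_mono fun t ht => ⟨lt_rearr_of_ofReal_lt_distribFun ht.2 ht.1, ht.2⟩)
  rcases eq_or_ne (distribFun Ω f a) ∞ with htop | htop
  · simp [htop]
  have hsub : {t | a < rearr Ω f t} ∩ Ioi 0 ⊆ Ioc 0 (distribFun Ω f a).toReal := fun t ht =>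
    ⟨ht.2, (ENNReal.ofReal_le_iff_le_toReal htop).1 <|
      not_lt.1 fun h => (rearr_le_of_distribFun_lt ht.2 h).not_gt ht.1⟩
  refine (measure_mono hsub).trans_eq ?_
  rw [Real.volume_Ioc, sub_zero, volume_setOf_pos_ofReal_lt, ENNReal.ofReal_toReal htop]

theorem lintegral_comp_rearr
    (hf : AEMeasurable f (volume.restrict (Ω : Set _)))
    {Φ : ℝ≥0∞ → ℝ≥0∞} (hΦ : Monotone Φ) (hΦc : Continuous Φ) (hΦ0 : Φ 0 = 0) :
    ∫⁻ t in Ioi 0, Φ (rearr Ω f t) = ∫⁻ x in Ω, Φ ‖f x‖ₑ :=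
  lintegral_comp_eq_of_meas_lt_eq measurable_rearr.aemeasurable hf.enorm
    (fun a => (restrict_Ioi_setOf_lt_rearr a).trans (restrict_setOf_lt_enorm Ω f a).symm) hΦ hΦc hΦ0

theorem eLpNorm_rearr (hf : AEMeasurable f (volume.restrict (Ω : Set _))) :
    eLpNorm (rearr Ω f) 2 (volume.restrict (Ioi 0)) = l2Norm Ω f := by
  have hsq := lintegral_comp_rearr hf (Φ := (· ^ 2)) (pow_left_mono 2) (ENNReal.continuous_pow 2)
    (by simp)
  rw [eLpNorm_two_eq, hsq, l2Norm, ← eLpNorm_two_eq, eLpNorm_enorm]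

theorem rearr_add_le {s : ℝ} (hs : 0 < s) (ht : 0 < t) :
    rearr Ω (fun x => f x + g x) (s + t) ≤ rearr Ω f s + rearr Ω g t := by
  refine ENNReal.le_of_forall_pos_le_add fun ε hε hfin => ?_
  obtain ⟨hfs, hgt⟩ := ENNReal.add_lt_top.1 hfin
  have hε2 : (ε / 2 : ℝ≥0∞) ≠ 0 := by simpa using hε.ne'
  set a := rearr Ω f s + ε / 2
  set b := rearr Ω g t + ε / 2
  have ha : distribFun Ω f a < ENNReal.ofReal s :=
    distribFun_lt_of_rearr_lt hs (ENNReal.lt_add_right hfs.ne hε2)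
  have hb : distribFun Ω g b < ENNReal.ofReal t :=
    distribFun_lt_of_rearr_lt ht (ENNReal.lt_add_right hgt.ne hε2)
  have hab : a + b = rearr Ω f s + rearr Ω g t + ε := by
    rw [add_add_add_comm, ENNReal.add_halves]
  have hsub : {x | x ∈ Ω ∧ a + b < ‖f x + g x‖ₑ} ⊆
      {x | x ∈ Ω ∧ a < ‖f x‖ₑ} ∪ {x | x ∈ Ω ∧ b < ‖g x‖ₑ} := by
    rintro x ⟨hx, hlt⟩
    by_contra! hcon
    simp only [mem_union, mem_ofPred_eq, hx, true_and, not_or, not_lt] at hcon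
    exact ((enorm_add_le _ _).trans (add_le_add hcon.1 hcon.2)).not_gt hlt
  rw [← hab]
  refine rearr_le_of_distribFun_lt (add_pos hs ht) ?_
  calc distribFun Ω (fun x => f x + g x) (a + b)
      ≤ distribFun Ω f a + distribFun Ω g b := (measure_mono hsub).trans (measure_union_le _ _)
    _ < ENNReal.ofReal s + ENNReal.ofReal t := ENNReal.add_lt_add ha hb
    _ = _ := (ENNReal.ofReal_add hs.le ht.le).symm

theorem rearr_mul_le_l2Norm
    (hf : AEMeasurable f (volume.restrict (Ω : Set _))) (t : ℝ) :
    rearr Ω f t * ENNReal.ofReal t ^ (1 / 2 : ℝ) ≤ l2Norm Ω f := by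
  calc rearr Ω f t * ENNReal.ofReal t ^ (1 / 2 : ℝ)
      = eLpNorm (fun _ : ℝ => rearr Ω f t) 2 (volume.restrict (Ioo 0 t)) := by
        simp [eLpNorm_const' (rearr Ω f t) two_ne_zero ENNReal.ofNat_ne_top]
    _ ≤ eLpNorm (rearr Ω f) 2 (volume.restrict (Ioo 0 t)) := by
        refine eLpNorm_mono_enorm_ae ?_
        filter_upwards [ae_restrict_mem measurableSet_Ioo] with τ hτ
        exact rearr_antitone hτ.2.le
    _ ≤ eLpNorm (rearr Ω f) 2 (volume.restrict (Ioi 0)) :=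
        eLpNorm_mono_measure _ (Measure.restrict_mono Ioo_subset_Ioi_self le_rfl)
    _ = l2Norm Ω f := eLpNorm_rearr hf

theorem rearr_le_liminf {F : ℕ → EuclideanSpace ℝ (Fin N) → ℝ}
    (hF : ∀ s > 0, Tendsto (fun n => rearr Ω (fun x => f x - F n x) s) atTop (𝓝 0)) {s : ℝ}
    (hs : 0 < s) (hst : s < t) : rearr Ω f t ≤ liminf (fun n => rearr Ω (F n) s) atTop := by
  have hle (n : ℕ) : rearr Ω f t ≤
      rearr Ω (fun x => f x - F n x) (t - s) + rearr Ω (F n) s := by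
    simpa using rearr_add_le (f := fun x => f x - F n x) (g := F n) (Ω := Ω) (sub_pos.2 hst) hs
  refine ENNReal.le_of_forall_pos_le_add fun ε hε _ => tsub_le_iff_right.1 ?_
  refine le_liminf_of_le (by isBoundedDefault) ?_
  filter_upwards [(hF (t - s) (sub_pos.2 hst)).eventually_le_const
    (ENNReal.coe_pos.2 hε)] with n hn
  exact tsub_le_iff_left.2 ((hle n).trans (by gcongr))

theorem ae_rearr_le_liminf {F : ℕ → EuclideanSpace ℝ (Fin N) → ℝ}
    (hF : ∀ s > 0, Tendsto (fun n => rearr Ω (fun x => f x - F n x) s) atTop (𝓝 0)) :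
    ∀ᵐ t, 0 < t → rearr Ω f t ≤ liminf (fun n => rearr Ω (F n) t) atTop := by
  have hanti : Antitone fun t => liminf (fun n => rearr Ω (F n) t) atTop := fun s t hst =>
    liminf_le_liminf (Eventually.of_forall fun n => rearr_antitone hst)
  filter_upwards [hanti.countable_not_continuousAt.ae_notMem volume] with t ht ht0
  have hcont := (not_not.1 ht).continuousWithinAt (s := Iio t)
  refine ge_of_tendsto hcont ?_
  filter_upwards [Ioo_mem_nhdsLT ht0] with s hs
  exact rearr_le_liminf hF hs.1 hs.2

theorem tendsto_rearr_of_tendsto_l2Norm {F : ℕ → EuclideanSpace ℝ (Fin N) → ℝ}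
    (hF : ∀ n, AEMeasurable (F n) (volume.restrict (Ω : Set _)))
    (h : Tendsto (fun n => l2Norm Ω (F n)) atTop (𝓝 0)) (ht : 0 < t) :
    Tendsto (fun n => rearr Ω (F n) t) atTop (𝓝 0) := by
  have ht' : ENNReal.ofReal t ^ (1 / 2 : ℝ) ≠ 0 := by simp [ht]
  have hdiv := ENNReal.Tendsto.div_const h (Or.inr ht')
  rw [ENNReal.zero_div] at hdiv
  exact tendsto_of_tendsto_of_tendsto_of_le_of_le tendsto_const_nhds hdiv (fun _ => zero_le)
    fun n => ENNReal.le_div_iff_mul_le (Or.inl ht') (by simp) |>.2 (rearr_mul_le_l2Norm (hF n) t)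

theorem lzQuasinorm_le_liminf {p q : ℝ≥0∞} (hq₀ : q ≠ 0) (hq : q ≠ ∞) (α : ℝ)
    {F : ℕ → EuclideanSpace ℝ (Fin N) → ℝ}
    (hF : ∀ n, AEMeasurable (fun x => f x - F n x)
      (volume.restrict (Ω : Set _)))
    (h : Tendsto (fun n => l2Norm Ω (fun x => f x - F n x)) atTop (𝓝 0)) :
    lzQuasinorm Ω p q α f ≤ liminf (fun n => lzQuasinorm Ω p q α (F n)) atTop := by
  refine eLpNorm_le_liminf_of_ae_le_liminf hq₀ hq
    (fun n => ((measurable_lzWeight Ω p q α).mul measurable_rearr).aemeasurable) ?_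
  have hae := ae_rearr_le_liminf fun s hs => tendsto_rearr_of_tendsto_l2Norm hF h hs
  filter_upwards [ae_restrict_of_ae hae, ae_restrict_mem measurableSet_Ioo] with t hle ht
  calc lzWeight Ω p q α t * rearr Ω f t
      ≤ lzWeight Ω p q α t * liminf (fun n => rearr Ω (F n) t) atTop := by
        gcongr
        exact hle ht.1
    _ = _ := (ENNReal.liminf_const_mul_of_ne_top ENNReal.ofReal_ne_top).symm

theorem setLIntegral_sub_rearr_add
    (hf : AEMeasurable f (volume.restrict (Ω : Set _))) (ht : 0 < t) :
    (∫⁻ x in Ω, (‖f x‖ₑ - rearr Ω f t)) + rearr Ω f t * ENNReal.ofReal t =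
      ∫⁻ τ in Ioo 0 t, rearr Ω f τ := by
  have hIoo : ∫⁻ τ in Ioi 0, (rearr Ω f τ - rearr Ω f t) =
      ∫⁻ τ in Ioo 0 t, (rearr Ω f τ - rearr Ω f t) := by
    rw [← Ioo_union_Ici_eq_Ioi ht, lintegral_union measurableSet_Ici
      (disjoint_left.2 fun τ hτ hτ' => hτ.2.not_ge hτ'), setLIntegral_eq_zero measurableSet_Ici
      fun τ hτ => tsub_eq_zero_of_le (rearr_antitone hτ), add_zero]
  rw [← lintegral_comp_rearr hf (Φ := fun a => a - rearr Ω f t)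
    (fun _ _ h => tsub_le_tsub_right h _) (ENNReal.continuous_sub_right _) (zero_tsub _), hIoo]
  calc _ = (∫⁻ τ in Ioo 0 t, (rearr Ω f τ - rearr Ω f t)) + ∫⁻ _ in Ioo 0 t, rearr Ω f t := by simp
    _ = ∫⁻ τ in Ioo 0 t, ((rearr Ω f τ - rearr Ω f t) + rearr Ω f t) :=
        (lintegral_add_right _ measurable_const).symm
    _ = _ := setLIntegral_congr_fun measurableSet_Ioo fun τ hτ =>
        tsub_add_cancel_of_le (rearr_antitone hτ.2.le)

theorem setLIntegral_le_setLIntegral_rearr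
    (hf : AEMeasurable f (volume.restrict (Ω : Set _))) (ht : 0 < t)
    {A : Set (EuclideanSpace ℝ (Fin N))} (hA : volume A ≤ ENNReal.ofReal t) :
    ∫⁻ x in A ∩ Ω, ‖f x‖ₑ ≤ ∫⁻ τ in Ioo 0 t, rearr Ω f τ := by
  calc ∫⁻ x in A ∩ Ω, ‖f x‖ₑ
      ≤ ∫⁻ x in A ∩ Ω, ((‖f x‖ₑ - rearr Ω f t) + rearr Ω f t) :=
        lintegral_mono fun x => le_tsub_add
    _ = (∫⁻ x in A ∩ Ω, (‖f x‖ₑ - rearr Ω f t)) + rearr Ω f t * volume (A ∩ Ω) := by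
        rw [lintegral_add_right _ measurable_const, setLIntegral_const]
    _ ≤ (∫⁻ x in Ω, (‖f x‖ₑ - rearr Ω f t)) + rearr Ω f t * ENNReal.ofReal t :=
        add_le_add (lintegral_mono_set inter_subset_right)
          (by gcongr; exact (measure_mono inter_subset_left).trans hA)
    _ = _ := setLIntegral_sub_rearr_add hf ht

theorem rearr_le_of_forall_setLIntegral_le (hf : Measurable f) (ht : 0 < t)
    (h : ∀ D ⊆ (Ω : Set _), MeasurableSet D →
      ENNReal.ofReal t ≤ volume D → volume D ≠ ∞ → ∫⁻ x in D, ‖f x‖ₑ ≤ a * volume D) :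
    rearr Ω f t ≤ a := by
  refine le_of_forall_lt_imp_le_of_dense fun b hb => ?_
  set S := {x | x ∈ Ω ∧ b < ‖f x‖ₑ}
  have hSm : MeasurableSet S :=
    Ω.isOpen.measurableSet.inter (measurableSet_lt measurable_const hf.enorm)
  have htS : ENNReal.ofReal t ≤ volume S :=
    not_lt.1 fun h => (rearr_le_of_distribFun_lt ht h).not_gt hb
  obtain ⟨D, hDm, hDS, htD, hD⟩ :
      ∃ D, MeasurableSet D ∧ D ⊆ S ∧ ENNReal.ofReal t ≤ volume D ∧ volume D ≠ ∞ := by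
    by_cases hS : volume S = ∞
    · obtain ⟨D, hDm, hDS, htD, hD⟩ := Measure.exists_subset_measure_lt_top hSm
        (ENNReal.ofReal_lt_top.trans_eq hS.symm : ENNReal.ofReal t < volume S)
      exact ⟨D, hDm, hDS, htD.le, hD.ne⟩
    · exact ⟨S, hSm, subset_rfl, htS, hS⟩
  have hD0 : volume D ≠ 0 := ((ENNReal.ofReal_pos.2 ht).trans_le htD).ne'
  refine (ENNReal.mul_le_mul_iff_left hD0 hD).1 ?_
  calc b * volume D = ∫⁻ _ in D, b := by simp
    _ ≤ ∫⁻ x in D, ‖f x‖ₑ := setLIntegral_mono' hDm fun x hx => (hDS hx).2.le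
    _ ≤ a * volume D := h D (fun x hx => (hDS hx).1) hDm htD hD

end Rearrangement

section RieszPotential

variable {N : ℕ} {Ω : Opens (EuclideanSpace ℝ (Fin N))} {f g : EuclideanSpace ℝ (Fin N) → ℝ}
  {D : Set (EuclideanSpace ℝ (Fin N))} {F : EuclideanSpace ℝ (Fin N) → ℝ≥0∞} {α r t : ℝ}

/-- The volume of the unit ball of `ℝ^N`. -/
noncomputable def unitBallVolume (N : ℕ) : ℝ :=
  volume.real (Metric.ball (0 : EuclideanSpace ℝ (Fin N)) 1)

theorem unitBallVolume_pos (N : ℕ) : 0 < unitBallVolume N :=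
  ENNReal.toReal_pos (Metric.measure_ball_pos volume _ one_pos).ne' measure_ball_lt_top.ne

theorem volume_ball_eq (x : EuclideanSpace ℝ (Fin N)) (hr : 0 < r) :
    volume (Metric.ball x r) = ENNReal.ofReal (unitBallVolume N * r ^ N) := by
  rw [Measure.addHaar_ball_of_pos _ _ hr, mul_comm, unitBallVolume,
    ENNReal.ofReal_mul measureReal_nonneg, ofReal_measureReal measure_ball_lt_top.ne,
    finrank_euclideanSpace_fin]

/-- The Riesz potential of order `α` of `|g|` over `Ω`, as an integral over the radii of balls:
by Tonelli's theorem it is `(N - α)⁻¹ ∫_Ω |g y| |x - y|^(α - N) dy` when `α < N`. -/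
noncomputable def rieszPotential (Ω : Opens (EuclideanSpace ℝ (Fin N))) (α : ℝ)
    (g : EuclideanSpace ℝ (Fin N) → ℝ) (x : EuclideanSpace ℝ (Fin N)) : ℝ≥0∞ :=
  ∫⁻ r in Ioi 0, ENNReal.ofReal (r ^ (α - N - 1)) * ∫⁻ y in Metric.ball x r ∩ Ω, ‖g y‖ₑ

theorem measurable_setLIntegral_ball (Ω : Opens (EuclideanSpace ℝ (Fin N))) (hF : Measurable F) :
    Measurable fun p : EuclideanSpace ℝ (Fin N) × ℝ => ∫⁻ y in Metric.ball p.1 p.2 ∩ Ω, F y := by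
  have hS : MeasurableSet
      {q : (EuclideanSpace ℝ (Fin N) × ℝ) × EuclideanSpace ℝ (Fin N) | dist q.2 q.1.1 < q.1.2} :=
    measurableSet_lt (by fun_prop) (by fun_prop)
  have hmeas := ((hF.comp measurable_snd).indicator hS).lintegral_prod_right'
    (ν := volume.restrict (Ω : Set _))
  convert hmeas using 2 with p
  rw [← Measure.restrict_restrict measurableSet_ball, ← lintegral_indicator measurableSet_ball]
  rfl

theorem setLIntegral_setLIntegral_ball_le (hF : AEMeasurable F (volume.restrict Ω)) (hr : 0 < r)
    (D : Set (EuclideanSpace ℝ (Fin N))) :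
    ∫⁻ x in D, ∫⁻ y in Metric.ball x r ∩ Ω, F y ≤
      ENNReal.ofReal (unitBallVolume N * r ^ N) * ∫⁻ y in Ω, F y := by
  have hS : MeasurableSet
      {p : EuclideanSpace ℝ (Fin N) × EuclideanSpace ℝ (Fin N) | dist p.2 p.1 < r} :=
    measurableSet_lt (by fun_prop) (by fun_prop)
  have htonelli := lintegral_mul_setLIntegral_section_swap (μ := volume.restrict D) hS
    (aemeasurable_const (b := 1)) hF
  have hsec (x : EuclideanSpace ℝ (Fin N)) : ∫⁻ y in Metric.ball x r ∩ Ω, F y =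
      1 * ∫⁻ y in {y | (x, y) ∈ {p : EuclideanSpace ℝ (Fin N) × EuclideanSpace ℝ (Fin N) |
        dist p.2 p.1 < r}}, F y ∂volume.restrict Ω := by
    rw [one_mul, ← Measure.restrict_restrict measurableSet_ball]
    rfl
  simp only [hsec]
  rw [htonelli, ← lintegral_const_mul'' _ hF]
  refine lintegral_mono fun y => ?_
  rw [mul_comm, setLIntegral_one, ← volume_ball_eq y hr]
  refine mul_le_mul_left ((Measure.restrict_apply_le _ _).trans (measure_mono fun x hx => ?_)) _
  exact (dist_comm x y).trans_lt hx

theorem setLIntegral_setLIntegral_ball_le_rearr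
    (hg : AEMeasurable g (volume.restrict Ω)) (hr : 0 < r) (ht : 0 < t)
    (htD : ENNReal.ofReal t ≤ volume D) :
    ∫⁻ x in D, ∫⁻ y in Metric.ball x r ∩ Ω, ‖g y‖ₑ ≤
      ENNReal.ofReal (unitBallVolume N * r ^ N) *
        ((∫⁻ τ in Ioo 0 t, rearr Ω g τ) / ENNReal.ofReal t * volume D) := by
  set l := rearr Ω g t
  set b := ENNReal.ofReal (unitBallVolume N * r ^ N)
  have hball (x : EuclideanSpace ℝ (Fin N)) : ∫⁻ y in Metric.ball x r ∩ Ω, ‖g y‖ₑ ≤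
      (∫⁻ y in Metric.ball x r ∩ Ω, (‖g y‖ₑ - l)) + l * b := by
    calc ∫⁻ y in Metric.ball x r ∩ Ω, ‖g y‖ₑ
        ≤ ∫⁻ y in Metric.ball x r ∩ Ω, ((‖g y‖ₑ - l) + l) := lintegral_mono fun y => le_tsub_add
      _ = (∫⁻ y in Metric.ball x r ∩ Ω, (‖g y‖ₑ - l)) + l * volume (Metric.ball x r ∩ Ω) := by
          rw [lintegral_add_right _ measurable_const, setLIntegral_const]
      _ ≤ _ := by
          gcongr
          exact (measure_mono inter_subset_left).trans_eq (volume_ball_eq x hr)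
  have hone : 1 ≤ volume D / ENNReal.ofReal t := by
    rwa [ENNReal.le_div_iff_mul_le (by simp [ht]) (by simp), one_mul]
  have hdiv : ENNReal.ofReal t * (volume D / ENNReal.ofReal t) = volume D :=
    ENNReal.mul_div_cancel (by simp [ht]) ENNReal.ofReal_ne_top
  calc ∫⁻ x in D, ∫⁻ y in Metric.ball x r ∩ Ω, ‖g y‖ₑ
      ≤ ∫⁻ x in D, ((∫⁻ y in Metric.ball x r ∩ Ω, (‖g y‖ₑ - l)) + l * b) := lintegral_mono hball
    _ = (∫⁻ x in D, ∫⁻ y in Metric.ball x r ∩ Ω, (‖g y‖ₑ - l)) + l * b * volume D := by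
        rw [lintegral_add_right _ measurable_const, setLIntegral_const]
    _ ≤ b * (∫⁻ y in Ω, (‖g y‖ₑ - l)) * (volume D / ENNReal.ofReal t) +
          l * b * (ENNReal.ofReal t * (volume D / ENNReal.ofReal t)) := by
        rw [hdiv]
        gcongr
        exact (setLIntegral_setLIntegral_ball_le (hg.enorm.sub_const l) hr D).trans
          (le_mul_of_one_le_right' hone)
    _ = b * (((∫⁻ y in Ω, (‖g y‖ₑ - l)) + l * ENNReal.ofReal t) *
          (volume D / ENNReal.ofReal t)) := by ring
    _ = _ := by rw [setLIntegral_sub_rearr_add hg ht, mul_div, ENNReal.mul_div_right_comm]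

theorem lintegral_Ioc_rpow {p R : ℝ} (hp : -1 < p) (hR : 0 ≤ R) :
    ∫⁻ r in Ioc 0 R, ENNReal.ofReal (r ^ p) = ENNReal.ofReal (R ^ (p + 1) / (p + 1)) := by
  rw [← ofReal_integral_eq_lintegral_ofReal
      ((intervalIntegrable_iff_integrableOn_Ioc_of_le hR).1
        (intervalIntegral.intervalIntegrable_rpow' hp))
      (ae_restrict_of_forall_mem measurableSet_Ioc fun r hr => Real.rpow_nonneg hr.1.le p),
    ← intervalIntegral.integral_of_le hR, integral_rpow (Or.inl hp),
    Real.zero_rpow (by linarith), sub_zero]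

theorem lintegral_Ioi_rpow {p ρ : ℝ} (hp : p < -1) (hρ : 0 < ρ) :
    ∫⁻ r in Ioi ρ, ENNReal.ofReal (r ^ p) = ENNReal.ofReal (-ρ ^ (p + 1) / (p + 1)) := by
  rw [← ofReal_integral_eq_lintegral_ofReal (integrableOn_Ioi_rpow_of_lt hp hρ)
      (ae_restrict_of_forall_mem measurableSet_Ioi fun r hr => Real.rpow_nonneg (hρ.trans hr).le p),
    integral_Ioi_rpow_of_lt hp hρ]

/-- The majorant `∫₀^∞ max(t, τ)^(α/N - 1) g*(τ) dτ` in O'Neil's rearrangement inequality for the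
Riesz potential of order `α`; it is `t^(α/N) g**(t) + ∫_t^∞ τ^(α/N - 1) g*(τ) dτ`. -/
noncomputable def oneilMajorant (Ω : Opens (EuclideanSpace ℝ (Fin N))) (α : ℝ)
    (g : EuclideanSpace ℝ (Fin N) → ℝ) (t : ℝ) : ℝ≥0∞ :=
  ∫⁻ τ in Ioi 0, ENNReal.ofReal (max t τ ^ (α / N - 1)) * rearr Ω g τ

theorem setLIntegral_Ioo_rearr_le_oneilMajorant (Ω : Opens (EuclideanSpace ℝ (Fin N))) (α : ℝ)
    (g : EuclideanSpace ℝ (Fin N) → ℝ) (t : ℝ) :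
    ENNReal.ofReal (t ^ (α / N - 1)) * ∫⁻ τ in Ioo 0 t, rearr Ω g τ ≤ oneilMajorant Ω α g t := by
  rw [← lintegral_const_mul _ measurable_rearr]
  calc _ = ∫⁻ τ in Ioo 0 t, ENNReal.ofReal (max t τ ^ (α / N - 1)) * rearr Ω g τ :=
        setLIntegral_congr_fun measurableSet_Ioo fun τ hτ => by rw [max_eq_left hτ.2.le]
    _ ≤ _ := lintegral_mono_set Ioo_subset_Ioi_self

theorem setLIntegral_rpow_mul_setLIntegral_ball_le (α : ℝ) (hg : Measurable g) {r : ℝ}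
    (hr : 0 < r) (ht : 0 < t) (htD : ENNReal.ofReal t ≤ volume D) :
    ∫⁻ x in D, ENNReal.ofReal (r ^ (α - N - 1)) * ∫⁻ y in Metric.ball x r ∩ Ω, ‖g y‖ₑ ≤
      ENNReal.ofReal (r ^ (α - 1)) * (ENNReal.ofReal (unitBallVolume N) *
        ((∫⁻ τ in Ioo 0 t, rearr Ω g τ) / ENNReal.ofReal t * volume D)) := by
  have hpow : r ^ (α - 1) = r ^ (α - N - 1) * r ^ N := by
    rw [← Real.rpow_add_natCast hr.ne']
    ring_nf
  rw [lintegral_const_mul' _ _ ENNReal.ofReal_ne_top, hpow, ENNReal.ofReal_mul (by positivity),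
    mul_assoc, ← mul_assoc (ENNReal.ofReal (r ^ N)), ← ENNReal.ofReal_mul (by positivity),
    mul_comm (r ^ N)]
  gcongr
  exact setLIntegral_setLIntegral_ball_le_rearr hg.aemeasurable hr ht htD

theorem setLIntegral_potential_near_le (hα : 0 < α) (hg : Measurable g) (ht : 0 < t)
    (htD : ENNReal.ofReal t ≤ volume D) :
    ∫⁻ x in D, ∫⁻ r in Ioc 0 ((t / unitBallVolume N) ^ (N⁻¹ : ℝ)),
      ENNReal.ofReal (r ^ (α - N - 1)) * ∫⁻ y in Metric.ball x r ∩ Ω, ‖g y‖ₑ ≤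
      ENNReal.ofReal (unitBallVolume N ^ (1 - α / N) / α) * oneilMajorant Ω α g t * volume D := by
  have hω := unitBallVolume_pos N
  set ω := unitBallVolume N
  set R := (t / ω) ^ (N⁻¹ : ℝ) with hR
  set J := ∫⁻ τ in Ioo 0 t, rearr Ω g τ
  have hswap : AEMeasurable (Function.uncurry fun (x : EuclideanSpace ℝ (Fin N)) (r : ℝ) =>
      ENNReal.ofReal (r ^ (α - N - 1)) * ∫⁻ y in Metric.ball x r ∩ Ω, ‖g y‖ₑ)
      ((volume.restrict D).prod (volume.restrict (Ioc 0 R))) :=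
    ((by fun_prop : Measurable fun p : EuclideanSpace ℝ (Fin N) × ℝ =>
      ENNReal.ofReal (p.2 ^ (α - N - 1))).mul
        (measurable_setLIntegral_ball Ω hg.enorm)).aemeasurable
  have hconst : ω * (R ^ α / α) * t⁻¹ = ω ^ (1 - α / N) / α * t ^ (α / N - 1) := by
    rw [hR, ← Real.rpow_mul (by positivity), inv_mul_eq_div, Real.div_rpow ht.le hω.le,
      Real.rpow_sub hω, Real.rpow_sub ht, Real.rpow_one, Real.rpow_one]
    ring
  rw [lintegral_lintegral_swap hswap]
  calc ∫⁻ r in Ioc 0 R, ∫⁻ x in D,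
        ENNReal.ofReal (r ^ (α - N - 1)) * ∫⁻ y in Metric.ball x r ∩ Ω, ‖g y‖ₑ
      ≤ ∫⁻ r in Ioc 0 R, ENNReal.ofReal (r ^ (α - 1)) *
          (ENNReal.ofReal ω * (J / ENNReal.ofReal t * volume D)) :=
        setLIntegral_mono' measurableSet_Ioc fun r hr =>
          setLIntegral_rpow_mul_setLIntegral_ball_le α hg hr.1 ht htD
    _ = ENNReal.ofReal (ω * (R ^ α / α) * t⁻¹) * J * volume D := by
        rw [lintegral_mul_const _ (by fun_prop), lintegral_Ioc_rpow (by linarith) (by positivity),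
          sub_add_cancel, ENNReal.ofReal_mul (by positivity), ENNReal.ofReal_mul hω.le,
          ENNReal.ofReal_inv_of_pos ht, ENNReal.div_eq_inv_mul]
        ring
    _ ≤ ENNReal.ofReal (ω ^ (1 - α / N) / α) * oneilMajorant Ω α g t * volume D := by
        rw [hconst, ENNReal.ofReal_mul (by positivity), mul_assoc (ENNReal.ofReal _) _ J]
        gcongr
        exact setLIntegral_Ioo_rearr_le_oneilMajorant Ω α g t

theorem setLIntegral_radii_rpow_le (hα : α < N) (hN : 0 < N) (ht : 0 < t) (τ : ℝ) :
    ∫⁻ r in {r | τ < unitBallVolume N * r ^ N}, ENNReal.ofReal (r ^ (α - N - 1))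
        ∂volume.restrict (Ioi ((t / unitBallVolume N) ^ (N⁻¹ : ℝ))) ≤
      ENNReal.ofReal (unitBallVolume N ^ (1 - α / N) / (N - α)) *
        ENNReal.ofReal (max t τ ^ (α / N - 1)) := by
  have hω := unitBallVolume_pos N
  set ω := unitBallVolume N
  have hm : 0 < max t τ := lt_max_of_lt_left ht
  set m := max t τ
  have hsub : {r | τ < ω * r ^ N} ∩ Ioi ((t / ω) ^ (N⁻¹ : ℝ)) ⊆ Ioi ((m / ω) ^ (N⁻¹ : ℝ)) := by
    rintro r ⟨hτr, hr⟩
    have hr0 : 0 < r := lt_of_le_of_lt (by positivity) hr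
    have htr : t < ω * r ^ N := by
      rw [← div_lt_iff₀' hω, ← Real.rpow_inv_natCast_pow (div_pos ht hω).le hN.ne']
      exact pow_lt_pow_left₀ hr (by positivity) hN.ne'
    rw [mem_Ioi, ← Real.pow_rpow_inv_natCast hr0.le hN.ne']
    refine Real.rpow_lt_rpow (by positivity) ?_ (by positivity)
    rw [div_lt_iff₀' hω]
    exact max_lt htr hτr
  have hconst : -((m / ω) ^ (N⁻¹ : ℝ)) ^ (α - N - 1 + 1) / (α - N - 1 + 1) =
      ω ^ (1 - α / N) / (N - α) * m ^ (α / N - 1) := by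
    have hexp : (N : ℝ)⁻¹ * (α - N) = α / N - 1 := by field_simp
    rw [sub_add_cancel, ← Real.rpow_mul (by positivity), hexp, Real.div_rpow hm.le hω.le,
      ← neg_sub (N : ℝ) α, neg_div_neg_eq, ← neg_sub (α / N), Real.rpow_neg hω.le]
    ring
  rw [Measure.restrict_restrict (measurableSet_lt (by fun_prop) (by fun_prop)),
    ← ENNReal.ofReal_mul (div_nonneg (by positivity) (sub_pos.2 hα).le), ← hconst,
    ← lintegral_Ioi_rpow (by linarith) (by positivity)]
  exact lintegral_mono_set hsub

theorem lintegral_potential_far_le (hα : α < N) (hN : 0 < N) (hg : Measurable g) (ht : 0 < t)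
    (x : EuclideanSpace ℝ (Fin N)) :
    ∫⁻ r in Ioi ((t / unitBallVolume N) ^ (N⁻¹ : ℝ)),
      ENNReal.ofReal (r ^ (α - N - 1)) * ∫⁻ y in Metric.ball x r ∩ Ω, ‖g y‖ₑ ≤
      ENNReal.ofReal (unitBallVolume N ^ (1 - α / N) / (N - α)) * oneilMajorant Ω α g t := by
  have hω := unitBallVolume_pos N
  set ω := unitBallVolume N
  set R := (t / ω) ^ (N⁻¹ : ℝ)
  calc ∫⁻ r in Ioi R, ENNReal.ofReal (r ^ (α - N - 1)) * ∫⁻ y in Metric.ball x r ∩ Ω, ‖g y‖ₑ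
      ≤ ∫⁻ r in Ioi R, ENNReal.ofReal (r ^ (α - N - 1)) *
          ∫⁻ τ in {τ | (r, τ) ∈ {p : ℝ × ℝ | p.2 < ω * p.1 ^ N}},
            rearr Ω g τ ∂volume.restrict (Ioi 0) := by
        refine setLIntegral_mono' measurableSet_Ioi fun r hr => ?_
        have hr0 : 0 < r := lt_of_le_of_lt (by positivity) hr
        gcongr
        refine (setLIntegral_le_setLIntegral_rearr hg.aemeasurable (by positivity)
          (volume_ball_eq x hr0).le).trans_eq ?_
        change _ = ∫⁻ τ in Iio (ω * r ^ N), rearr Ω g τ ∂volume.restrict (Ioi 0)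
        rw [Measure.restrict_restrict measurableSet_Iio, inter_comm, Ioi_inter_Iio]
    _ = ∫⁻ τ in Ioi 0, rearr Ω g τ *
          ∫⁻ r in {r | τ < ω * r ^ N}, ENNReal.ofReal (r ^ (α - N - 1)) ∂volume.restrict (Ioi R) :=
        lintegral_mul_setLIntegral_section_swap (measurableSet_lt (by fun_prop) (by fun_prop))
          (by fun_prop) measurable_rearr.aemeasurable
    _ ≤ ∫⁻ τ in Ioi 0, ENNReal.ofReal (ω ^ (1 - α / N) / (N - α)) *
          (ENNReal.ofReal (max t τ ^ (α / N - 1)) * rearr Ω g τ) := by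
        refine setLIntegral_mono' measurableSet_Ioi fun τ _ => ?_
        rw [← mul_assoc, mul_comm]
        gcongr
        exact setLIntegral_radii_rpow_le hα hN ht τ
    _ = _ := lintegral_const_mul' _ _ ENNReal.ofReal_ne_top

theorem setLIntegral_rieszPotential_le (hα : 0 < α) (hαN : α < N) (hg : Measurable g)
    (ht : 0 < t) (htD : ENNReal.ofReal t ≤ volume D) :
    ∫⁻ x in D, rieszPotential Ω α g x ≤
      ENNReal.ofReal ((α⁻¹ + (N - α)⁻¹) * unitBallVolume N ^ (1 - α / N)) *
        oneilMajorant Ω α g t * volume D := by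
  have hω := unitBallVolume_pos N
  have hN : 0 < N := Nat.cast_pos.1 (hα.trans hαN)
  have hαN₀ : 0 < N - α := sub_pos.2 hαN
  set ω := unitBallVolume N
  set M := oneilMajorant Ω α g t
  set R := (t / ω) ^ (N⁻¹ : ℝ)
  have hR : 0 ≤ R := by positivity
  calc ∫⁻ x in D, rieszPotential Ω α g x
      ≤ ∫⁻ x in D, ((∫⁻ r in Ioc 0 R, ENNReal.ofReal (r ^ (α - N - 1)) *
          ∫⁻ y in Metric.ball x r ∩ Ω, ‖g y‖ₑ) +
            ENNReal.ofReal (ω ^ (1 - α / N) / (N - α)) * M) := by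
        refine lintegral_mono fun x => ?_
        rw [rieszPotential, ← Ioc_union_Ioi_eq_Ioi hR]
        exact (lintegral_union_le _ _ _).trans
          (by gcongr; exact lintegral_potential_far_le hαN hN hg ht x)
    _ ≤ ENNReal.ofReal (ω ^ (1 - α / N) / α) * M * volume D +
          ENNReal.ofReal (ω ^ (1 - α / N) / (N - α)) * M * volume D := by
        rw [lintegral_add_right _ measurable_const, setLIntegral_const]
        gcongr
        exact setLIntegral_potential_near_le hα hg ht htD
    _ = _ := by
        rw [← add_mul, ← add_mul, ← ENNReal.ofReal_add (div_nonneg (by positivity) hα.le)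
          (div_nonneg (by positivity) hαN₀.le)]
        ring_nf

theorem rearr_le_oneilMajorant (hα : 0 < α) (hαN : α < N) (hf : Measurable f) (hg : Measurable g)
    (hfg : ∀ x ∈ Ω, ENNReal.ofReal (unitBallVolume N) * ‖f x‖ₑ ≤ rieszPotential Ω α g x)
    (ht : 0 < t) :
    rearr Ω f t ≤ ENNReal.ofReal ((α⁻¹ + (N - α)⁻¹) * unitBallVolume N ^ (-(α / N))) *
      oneilMajorant Ω α g t := by
  have hω := unitBallVolume_pos N
  refine rearr_le_of_forall_setLIntegral_le hf ht fun D hDΩ hD htD _ => ?_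
  have hω₀ : ENNReal.ofReal (unitBallVolume N) ≠ 0 := (ENNReal.ofReal_pos.2 hω).ne'
  refine (ENNReal.mul_le_mul_iff_right hω₀ ENNReal.ofReal_ne_top).1 ?_
  have hconst : (α⁻¹ + (N - α)⁻¹) * unitBallVolume N ^ (1 - α / N) =
      unitBallVolume N * ((α⁻¹ + (N - α)⁻¹) * unitBallVolume N ^ (-(α / N))) := by
    rw [sub_eq_add_neg 1, Real.rpow_add hω, Real.rpow_one, mul_left_comm]
  calc ENNReal.ofReal (unitBallVolume N) * ∫⁻ x in D, ‖f x‖ₑ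
      = ∫⁻ x in D, ENNReal.ofReal (unitBallVolume N) * ‖f x‖ₑ :=
        (lintegral_const_mul' _ _ ENNReal.ofReal_ne_top).symm
    _ ≤ ∫⁻ x in D, rieszPotential Ω α g x := setLIntegral_mono' hD fun x hx => hfg x (hDΩ hx)
    _ ≤ _ := setLIntegral_rieszPotential_le hα hαN hg ht htD
    _ = _ := by rw [hconst, ENNReal.ofReal_mul hω.le, mul_assoc, mul_assoc, mul_assoc]

end RieszPotential

section HardyInequalities

variable {h : ℝ → ℝ≥0∞} {V t τ : ℝ}

theorem sq_lintegral_mul_le {α : Type*} [MeasurableSpace α] {μ : Measure α} {F G : α → ℝ≥0∞}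
    (hF : AEMeasurable F μ) (hG : AEMeasurable G μ) :
    (∫⁻ x, F x * G x ∂μ) ^ 2 ≤ (∫⁻ x, F x ^ 2 ∂μ) * ∫⁻ x, G x ^ 2 ∂μ := by
  have hsqrt (a : ℝ≥0∞) : (a ^ (1 / 2 : ℝ)) ^ 2 = a := by
    rw [← ENNReal.rpow_natCast, ← ENNReal.rpow_mul]
    norm_num
  have hCS := ENNReal.lintegral_mul_le_Lp_mul_Lq μ Real.HolderConjugate.two_two hF hG
  simp only [Pi.mul_apply, ENNReal.rpow_two] at hCS
  calc _ ≤ ((∫⁻ x, F x ^ 2 ∂μ) ^ (1 / 2 : ℝ) * (∫⁻ x, G x ^ 2 ∂μ) ^ (1 / 2 : ℝ)) ^ 2 := by gcongr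
    _ = _ := by rw [mul_pow, hsqrt, hsqrt]

theorem eLpNorm_two_le_of_lintegral_sq_le {α β : Type*} [MeasurableSpace α] [MeasurableSpace β]
    {μ : Measure α} {ν : Measure β} {F : α → ℝ≥0∞} {G : β → ℝ≥0∞} {c : ℝ≥0∞}
    (hFG : ∫⁻ x, F x ^ 2 ∂μ ≤ c ^ 2 * ∫⁻ y, G y ^ 2 ∂ν) :
    eLpNorm F 2 μ ≤ c * eLpNorm G 2 ν := by
  rw [eLpNorm_two_eq, eLpNorm_two_eq]
  calc (∫⁻ x, F x ^ 2 ∂μ) ^ (1 / 2 : ℝ) ≤ (c ^ 2 * ∫⁻ y, G y ^ 2 ∂ν) ^ (1 / 2 : ℝ) := by gcongr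
    _ = c * (∫⁻ y, G y ^ 2 ∂ν) ^ (1 / 2 : ℝ) := by
      rw [ENNReal.mul_rpow_of_nonneg _ _ (by norm_num), ← ENNReal.rpow_natCast_mul]
      norm_num

theorem sq_setLIntegral_Ioo_le (hh : Measurable h) (ht : 0 ≤ t) :
    (∫⁻ τ in Ioo 0 t, h τ) ^ 2 ≤
      ENNReal.ofReal (2 * t ^ (1 / 2 : ℝ)) *
        ∫⁻ τ in Ioo 0 t, ENNReal.ofReal (τ ^ (1 / 2 : ℝ)) * h τ ^ 2 := by
  have hCS := sq_lintegral_mul_le (μ := volume.restrict (Ioo 0 t))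
    (F := fun τ => ENNReal.ofReal (τ ^ (-(1 / 4) : ℝ)))
    (G := fun τ => ENNReal.ofReal (τ ^ (1 / 4 : ℝ)) * h τ) (by fun_prop) (by fun_prop)
  have hcancel : ∫⁻ τ in Ioo 0 t, ENNReal.ofReal (τ ^ (-(1 / 4) : ℝ)) *
      (ENNReal.ofReal (τ ^ (1 / 4 : ℝ)) * h τ) = ∫⁻ τ in Ioo 0 t, h τ :=
    setLIntegral_congr_fun measurableSet_Ioo fun τ hτ => by
      rw [← mul_assoc, ← ENNReal.ofReal_mul (Real.rpow_nonneg hτ.1.le _), ← Real.rpow_add hτ.1,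
        neg_add_cancel, Real.rpow_zero, ENNReal.ofReal_one, one_mul]
  have hsq {τ p : ℝ} (hτ : τ ∈ Ioo 0 t) :
      ENNReal.ofReal (τ ^ p) ^ 2 = ENNReal.ofReal (τ ^ (p * 2)) := by
    rw [← ENNReal.ofReal_pow (Real.rpow_nonneg hτ.1.le _), ← Real.rpow_mul_natCast hτ.1.le]
    norm_num
  have hfirst : ∫⁻ τ in Ioo 0 t, ENNReal.ofReal (τ ^ (-(1 / 4) : ℝ)) ^ 2 =
      ENNReal.ofReal (2 * t ^ (1 / 2 : ℝ)) := by
    rw [setLIntegral_congr_fun measurableSet_Ioo fun τ hτ => hsq hτ, restrict_Ioo_eq_restrict_Ioc,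
      lintegral_Ioc_rpow (by norm_num) ht]
    congr 1
    norm_num
    ring
  have hsecond : ∫⁻ τ in Ioo 0 t, (ENNReal.ofReal (τ ^ (1 / 4 : ℝ)) * h τ) ^ 2 =
      ∫⁻ τ in Ioo 0 t, ENNReal.ofReal (τ ^ (1 / 2 : ℝ)) * h τ ^ 2 :=
    setLIntegral_congr_fun measurableSet_Ioo fun τ hτ => by
      rw [mul_pow, hsq hτ]
      norm_num
  rwa [hcancel, hfirst, hsecond] at hCS

theorem lintegral_sq_average_le (hh : Measurable h) :
    ∫⁻ t in Ioi 0, ((∫⁻ τ in Ioo 0 t, h τ) / ENNReal.ofReal t) ^ 2 ≤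
      2 ^ 2 * ∫⁻ τ in Ioi 0, h τ ^ 2 := by
  have hS : MeasurableSet {p : ℝ × ℝ | p.2 < p.1} := measurableSet_lt measurable_snd measurable_fst
  calc ∫⁻ t in Ioi 0, ((∫⁻ τ in Ioo 0 t, h τ) / ENNReal.ofReal t) ^ 2
      ≤ ∫⁻ t in Ioi 0, ENNReal.ofReal (2 * t ^ (-(3 / 2) : ℝ)) *
          ∫⁻ τ in {τ | (t, τ) ∈ {p : ℝ × ℝ | p.2 < p.1}},
            ENNReal.ofReal (τ ^ (1 / 2 : ℝ)) * h τ ^ 2 ∂volume.restrict (Ioi 0) := by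
        refine setLIntegral_mono' measurableSet_Ioi fun t (ht : 0 < t) => ?_
        change _ ≤ _ * ∫⁻ τ in Iio t, _ ∂volume.restrict (Ioi 0)
        have hpow : 2 * t ^ (-(3 / 2) : ℝ) = 2 * t ^ (1 / 2 : ℝ) * (t ^ 2)⁻¹ := by
          rw [mul_assoc, ← Real.rpow_natCast, ← Real.rpow_neg ht.le, ← Real.rpow_add ht]
          norm_num
        rw [Measure.restrict_restrict measurableSet_Iio, inter_comm, Ioi_inter_Iio, hpow,
          ENNReal.ofReal_mul (by positivity), ENNReal.ofReal_inv_of_pos (by positivity),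
          ENNReal.ofReal_pow ht.le, div_eq_mul_inv, mul_pow, ENNReal.inv_pow, mul_right_comm]
        gcongr
        exact sq_setLIntegral_Ioo_le hh ht.le
    _ = ∫⁻ τ in Ioi 0, ENNReal.ofReal (τ ^ (1 / 2 : ℝ)) * h τ ^ 2 *
          ∫⁻ t in {t | τ < t}, ENNReal.ofReal (2 * t ^ (-(3 / 2) : ℝ)) ∂volume.restrict (Ioi 0) :=
        lintegral_mul_setLIntegral_section_swap hS (by fun_prop) (by fun_prop)
    _ = ∫⁻ τ in Ioi 0, 2 ^ 2 * h τ ^ 2 := by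
        refine setLIntegral_congr_fun measurableSet_Ioi fun τ (hτ : 0 < τ) => ?_
        change _ * ∫⁻ t in Ioi τ, _ ∂volume.restrict (Ioi 0) = _
        have hpow : τ ^ (1 / 2 : ℝ) * (2 * (-τ ^ (-(3 / 2) + 1 : ℝ) / (-(3 / 2) + 1))) = 2 ^ 2 := by
          norm_num [Real.rpow_neg hτ.le]
          field_simp
          norm_num
        simp only [ENNReal.ofReal_mul zero_le_two]
        rw [Measure.restrict_restrict measurableSet_Ioi,
          inter_eq_left.2 (Ioi_subset_Ioi hτ.le), lintegral_const_mul _ (by fun_prop),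
          lintegral_Ioi_rpow (by norm_num) hτ, ← ENNReal.ofReal_mul zero_le_two, mul_right_comm,
          ← ENNReal.ofReal_mul (by positivity), hpow]
        norm_num
    _ = _ := lintegral_const_mul' _ _ (by norm_num)

theorem strictAnti_mul_exp (hV : 0 < V) : StrictAnti fun s => V * Real.exp (1 - s) :=
  fun _ _ hs => mul_lt_mul_of_pos_left (Real.exp_lt_exp.2 (sub_lt_sub_left hs 1)) hV

theorem lintegral_image_mul_exp (hV : 0 < V) {S : Set ℝ} (hS : MeasurableSet S) (G : ℝ → ℝ≥0∞) :
    ∫⁻ t in (fun s => V * Real.exp (1 - s)) '' S, G t =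
      ∫⁻ s in S, ENNReal.ofReal (V * Real.exp (1 - s)) * G (V * Real.exp (1 - s)) := by
  have hderiv (s : ℝ) : HasDerivAt (fun s => V * Real.exp (1 - s)) (-(V * Real.exp (1 - s))) s := by
    simpa using (((hasDerivAt_id s).const_sub 1).exp.const_mul V)
  simpa only [neg_neg] using lintegral_image_eq_lintegral_deriv_mul_of_antitoneOn hS
    (fun s _ => (hderiv s).hasDerivWithinAt) ((strictAnti_mul_exp hV).antitone.antitoneOn S) G

theorem image_mul_exp_Ioi (hV : 0 < V) :
    (fun s => V * Real.exp (1 - s)) '' Ioi 1 = Ioo 0 V := by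
  ext t
  constructor
  · rintro ⟨s, hs, rfl⟩
    exact ⟨by positivity, mul_lt_of_lt_one_right hV (Real.exp_lt_one_iff.2 (sub_neg.2 hs))⟩
  · rintro ⟨h0, htV⟩
    refine ⟨1 - Real.log (t / V), ?_, ?_⟩
    · have := Real.log_neg (div_pos h0 hV) ((div_lt_one hV).2 htV)
      rw [mem_Ioi]
      linarith
    · simp [Real.exp_log (div_pos h0 hV), mul_div_cancel₀ _ hV.ne']

theorem image_mul_exp_Ioo (hV : 0 < V) (s : ℝ) :
    (fun s => V * Real.exp (1 - s)) '' Ioo 1 s = Ioo (V * Real.exp (1 - s)) V := by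
  have hanti := strictAnti_mul_exp hV
  rw [← Ioi_inter_Iio, image_inter hanti.injective, image_mul_exp_Ioi hV]
  ext t
  constructor
  · rintro ⟨ht, s', hs', rfl⟩
    exact ⟨hanti hs', ht.2⟩
  · rintro ⟨hst, htV⟩
    have ht : t ∈ Ioo 0 V := ⟨(by positivity : 0 < V * Real.exp (1 - s)).trans hst, htV⟩
    obtain ⟨s', -, rfl⟩ := (image_mul_exp_Ioi hV).symm ▸ ht
    exact ⟨ht, s', hanti.lt_iff_gt.1 hst, rfl⟩

/-- The weight `t^(-1/2) / log (e V / t)` on `(0, V)` that defines the quasinorm of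
`L^{∞,2}(log L)^{-1}` on a set of measure `V`. -/
noncomputable def logWeight (V t : ℝ) : ℝ :=
  (Real.log (Real.exp 1 * V / t))⁻¹ * t ^ (-(1 / 2) : ℝ)

theorem one_le_log_exp_one_mul_div (ht : 0 < t) (htV : t ≤ V) :
    1 ≤ Real.log (Real.exp 1 * V / t) := by
  have hV : 0 < V := ht.trans_le htV
  rw [Real.le_log_iff_exp_le (by positivity), le_div_iff₀ ht]
  gcongr

theorem measurable_logWeight (V : ℝ) : Measurable (logWeight V) := by
  unfold logWeight
  fun_prop

theorem logWeight_mul_exp (hV : 0 < V) (s : ℝ) :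
    logWeight V (V * Real.exp (1 - s)) = s⁻¹ * (V * Real.exp (1 - s)) ^ (-(1 / 2) : ℝ) := by
  have : Real.exp 1 * V / (V * Real.exp (1 - s)) = Real.exp s := by
    rw [Real.exp_sub]
    field_simp
  rw [logWeight, this, Real.log_exp]

theorem rpow_half_mul_rpow_neg_half (ht : 0 < t) :
    ENNReal.ofReal (t ^ (1 / 2 : ℝ)) * ENNReal.ofReal (t ^ (-(1 / 2) : ℝ)) = 1 := by
  rw [← ENNReal.ofReal_mul (by positivity), ← Real.rpow_add ht]
  norm_num

theorem ofReal_rpow_half_sq (ht : 0 ≤ t) :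
    ENNReal.ofReal (t ^ (1 / 2 : ℝ)) ^ 2 = ENNReal.ofReal t := by
  rw [← ENNReal.ofReal_pow (by positivity), ← Real.rpow_mul_natCast ht]
  norm_num

/-- The pullback of `h` under the substitution `t = V e^(1 - s)`, that is `s = log (e V / t)`,
normalized to be an isometry from `L²(0, V)` to `L²(1, ∞)` and extended by `0` to `s ≤ 1`. -/
noncomputable def logPullback (V : ℝ) (h : ℝ → ℝ≥0∞) : ℝ → ℝ≥0∞ :=
  (Ioi 1).indicator fun s =>
    ENNReal.ofReal ((V * Real.exp (1 - s)) ^ (1 / 2 : ℝ)) * h (V * Real.exp (1 - s))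

theorem measurable_logPullback (hh : Measurable h) : Measurable (logPullback V h) :=
  Measurable.indicator (by fun_prop) measurableSet_Ioi

theorem lintegral_logPullback_sq (hV : 0 < V) :
    ∫⁻ s in Ioi 0, logPullback V h s ^ 2 = ∫⁻ t in Ioo 0 V, h t ^ 2 := by
  have hsq : (fun s => logPullback V h s ^ 2) = (Ioi 1).indicator fun s =>
      ENNReal.ofReal (V * Real.exp (1 - s)) * h (V * Real.exp (1 - s)) ^ 2 := by
    ext s
    by_cases hs : s ∈ Ioi 1
    · simp only [logPullback, indicator_of_mem hs, mul_pow]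
      rw [ofReal_rpow_half_sq (by positivity)]
    · simp [logPullback, indicator_of_notMem hs]
  rw [hsq, lintegral_indicator measurableSet_Ioi, Measure.restrict_restrict measurableSet_Ioi,
    inter_eq_left.2 (Ioi_subset_Ioi zero_le_one), ← image_mul_exp_Ioi hV,
    lintegral_image_mul_exp hV measurableSet_Ioi]

theorem setLIntegral_tail_eq_logPullback (hV : 0 < V) (s : ℝ) :
    ∫⁻ τ in Ioo (V * Real.exp (1 - s)) V, ENNReal.ofReal (τ ^ (-(1 / 2) : ℝ)) * h τ =
      ∫⁻ s' in Ioo 1 s, logPullback V h s' := by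
  rw [← image_mul_exp_Ioo hV, lintegral_image_mul_exp hV measurableSet_Ioo]
  refine setLIntegral_congr_fun measurableSet_Ioo fun s' hs' => ?_
  have hψ : 0 < V * Real.exp (1 - s') := by positivity
  rw [logPullback, indicator_of_mem (mem_Ioi.2 hs'.1), ← ofReal_rpow_half_sq hψ.le, ← mul_assoc,
    sq, mul_assoc _ _ (ENNReal.ofReal _), rpow_half_mul_rpow_neg_half hψ, mul_one]

theorem eLpNorm_logWeight_mul_tail_le (hV : 0 < V) (hh : Measurable h) :
    eLpNorm (fun t => ENNReal.ofReal (logWeight V t) *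
        ∫⁻ τ in Ioo t V, ENNReal.ofReal (τ ^ (-(1 / 2) : ℝ)) * h τ) 2 (volume.restrict (Ioo 0 V)) ≤
      2 * eLpNorm h 2 (volume.restrict (Ioo 0 V)) := by
  refine eLpNorm_two_le_of_lintegral_sq_le ?_
  set k := logPullback V h
  conv_lhs => rw [← image_mul_exp_Ioi hV, lintegral_image_mul_exp hV measurableSet_Ioi]
  calc _ ≤ ∫⁻ s in Ioi 1, ((∫⁻ s' in Ioo 0 s, k s') / ENNReal.ofReal s) ^ 2 := by
        refine setLIntegral_mono' measurableSet_Ioi fun s (hs : 1 < s) => ?_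
        have hs0 : 0 < s := zero_lt_one.trans hs
        have hψ : 0 < V * Real.exp (1 - s) := by positivity
        rw [setLIntegral_tail_eq_logPullback hV, logWeight_mul_exp hV, ← ofReal_rpow_half_sq hψ.le,
          ← mul_pow, ENNReal.ofReal_mul (by positivity), ENNReal.ofReal_inv_of_pos hs0,
          ENNReal.div_eq_inv_mul, ← mul_assoc, mul_left_comm, rpow_half_mul_rpow_neg_half hψ,
          mul_one]
        gcongr
        exact zero_le_one
    _ ≤ ∫⁻ s in Ioi 0, ((∫⁻ s' in Ioo 0 s, k s') / ENNReal.ofReal s) ^ 2 :=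
        lintegral_mono_set (Ioi_subset_Ioi zero_le_one)
    _ ≤ 2 ^ 2 * ∫⁻ s in Ioi 0, k s ^ 2 := lintegral_sq_average_le (measurable_logPullback hh)
    _ = 2 ^ 2 * ∫⁻ τ in Ioo 0 V, h τ ^ 2 := by rw [lintegral_logPullback_sq hV]

theorem logWeight_le_two_mul (hτ : 0 < τ) (hτt : τ ≤ t) (ht : t < V) :
    logWeight V t ≤ 2 * logWeight V τ := by
  have ht0 : 0 < t := hτ.trans_le hτt
  have hV : 0 < V := ht0.trans ht
  set y := (t / τ) ^ (1 / 2 : ℝ) with hy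
  set l := Real.log (Real.exp 1 * V / t) with hl
  have hl1 : 1 ≤ l := one_le_log_exp_one_mul_div ht0 ht.le
  have hlog : Real.log (Real.exp 1 * V / τ) = l + 2 * Real.log y := by
    rw [hy, hl, Real.log_rpow (by positivity), ← mul_assoc, ← Real.log_rpow (by positivity),
      ← Real.log_mul (by positivity) (by positivity)]
    congr 1
    norm_num
    field_simp
  have hy0 : 0 < y := by positivity
  have hlogy : Real.log y ≤ y - 1 := Real.log_le_sub_one_of_pos hy0
  have hlogy0 : 0 ≤ Real.log y :=
    Real.log_nonneg (Real.one_le_rpow ((one_le_div hτ).2 hτt) (by norm_num))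
  have hpow : τ ^ (-(1 / 2) : ℝ) = y * t ^ (-(1 / 2) : ℝ) := by
    rw [hy, Real.div_rpow ht0.le hτ.le, Real.rpow_neg ht0.le, Real.rpow_neg hτ.le]
    field_simp
  rw [logWeight, logWeight, hpow, hlog, ← mul_assoc, ← mul_assoc]
  gcongr
  rw [← div_eq_mul_inv, div_mul_eq_mul_div, inv_eq_one_div,
    div_le_div_iff₀ (by positivity) (by positivity)]
  nlinarith [mul_nonneg hlogy0 (sub_nonneg.2 hl1)]

theorem eLpNorm_logWeight_mul_average_le (hh : Measurable h) :
    eLpNorm (fun t => ENNReal.ofReal (logWeight V t) * ((∫⁻ τ in Ioo 0 t, h τ) / ENNReal.ofReal t))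
        2 (volume.restrict (Ioo 0 V)) ≤
      4 * eLpNorm (fun t => ENNReal.ofReal (logWeight V t) * h t) 2
        (volume.restrict (Ioo 0 V)) := by
  set k : ℝ → ℝ≥0∞ := (Ioo 0 V).indicator fun t => ENNReal.ofReal (logWeight V t) * h t
  have hk : Measurable k :=
    ((measurable_logWeight V).ennreal_ofReal.mul hh).indicator measurableSet_Ioo
  have hpoint {t : ℝ} (ht : t ∈ Ioo 0 V) :
      ENNReal.ofReal (logWeight V t) * ((∫⁻ τ in Ioo 0 t, h τ) / ENNReal.ofReal t) ≤
        2 * ((∫⁻ τ in Ioo 0 t, k τ) / ENNReal.ofReal t) := by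
    rw [← mul_div_assoc, ← mul_div_assoc, ← lintegral_const_mul _ hh, ← lintegral_const_mul _ hk]
    gcongr ?_ / _
    refine setLIntegral_mono' measurableSet_Ioo fun τ hτ => ?_
    have hτV : τ ∈ Ioo 0 V := ⟨hτ.1, hτ.2.trans ht.2⟩
    rw [show k τ = _ from indicator_of_mem hτV _, ← mul_assoc,
      ← ENNReal.ofReal_ofNat 2, ← ENNReal.ofReal_mul zero_le_two]
    gcongr
    exact logWeight_le_two_mul hτ.1 hτ.2.le ht.2
  have hmain : eLpNorm (fun t => (∫⁻ τ in Ioo 0 t, k τ) / ENNReal.ofReal t) 2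
      (volume.restrict (Ioi 0)) ≤ 2 * eLpNorm k 2 (volume.restrict (Ioi 0)) :=
    eLpNorm_two_le_of_lintegral_sq_le (lintegral_sq_average_le hk)
  calc _ ≤ ((2 : ℝ≥0) : ℝ≥0∞) * eLpNorm (fun t => (∫⁻ τ in Ioo 0 t, k τ) / ENNReal.ofReal t) 2
        (volume.restrict (Ioo 0 V)) :=
        eLpNorm_le_mul_eLpNorm_of_ae_le_mul'
          (ae_restrict_of_forall_mem measurableSet_Ioo fun t ht => hpoint ht) 2
    _ ≤ 2 * (2 * eLpNorm k 2 (volume.restrict (Ioi 0))) := by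
        refine mul_le_mul_right ?_ _
        exact (eLpNorm_mono_measure _ (Measure.restrict_mono_set _ Ioo_subset_Ioi_self)).trans hmain
    _ = _ := by
        rw [eLpNorm_indicator_eq_eLpNorm_restrict measurableSet_Ioo,
          Measure.restrict_restrict measurableSet_Ioo, inter_eq_left.2 Ioo_subset_Ioi_self,
          ← mul_assoc]
        norm_num

end HardyInequalities

section LorentzZygmundNorms

variable {N : ℕ} {Ω : Opens (EuclideanSpace ℝ (Fin N))} {f g : EuclideanSpace ℝ (Fin N) → ℝ}
  {α V t : ℝ}

theorem lzWeight_top_two_neg_one (Ω : Opens (EuclideanSpace ℝ (Fin N))) (t : ℝ) :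
    lzWeight Ω ∞ 2 (-1) t =
      ENNReal.ofReal (logWeight (volume.real (Ω : Set (EuclideanSpace ℝ (Fin N)))) t) := by
  simp [lzWeight, logWeight, Real.rpow_neg_one, measureReal_def]

theorem lzNorm_le_lzQuasinorm (Ω : Opens (EuclideanSpace ℝ (Fin N)))
    (f : EuclideanSpace ℝ (Fin N) → ℝ) :
    lzNorm Ω ∞ 2 (-1) f ≤ 4 * lzQuasinorm Ω ∞ 2 (-1) f := by
  simp only [lzNorm, lzQuasinorm, lzWeight_top_two_neg_one]
  exact eLpNorm_logWeight_mul_average_le measurable_rearr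

theorem logWeight_mul_rpow_neg_half_le (ht : t ∈ Ioo 0 V) :
    logWeight V t * t ^ (-(1 / 2) : ℝ) ≤ t⁻¹ := by
  have hpow : t ^ (-(1 / 2) : ℝ) * t ^ (-(1 / 2) : ℝ) = t⁻¹ := by
    rw [← Real.rpow_add ht.1, ← Real.rpow_neg_one]
    norm_num
  rw [logWeight, mul_assoc, hpow]
  exact mul_le_of_le_one_left (inv_nonneg.2 ht.1.le) <|
    inv_le_one_of_one_le₀ (one_le_log_exp_one_mul_div ht.1 ht.2.le)

theorem oneilMajorant_le (hΩ : volume (Ω : Set (EuclideanSpace ℝ (Fin N))) ≠ ∞) (α : ℝ)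
    (g : EuclideanSpace ℝ (Fin N) → ℝ)
    (ht : t ∈ Ioo 0 (volume.real (Ω : Set (EuclideanSpace ℝ (Fin N))))) :
    oneilMajorant Ω α g t ≤ ENNReal.ofReal (t ^ (α / N - 1)) * (∫⁻ τ in Ioo 0 t, rearr Ω g τ) +
      ∫⁻ τ in Ioo t (volume.real (Ω : Set (EuclideanSpace ℝ (Fin N)))),
        ENNReal.ofReal (τ ^ (α / N - 1)) * rearr Ω g τ := by
  set V := volume.real (Ω : Set (EuclideanSpace ℝ (Fin N)))
  set k : ℝ → ℝ≥0∞ := fun τ => ENNReal.ofReal (max t τ ^ (α / N - 1)) * rearr Ω g τ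
  have hsmall : ∫⁻ τ in Ioc 0 t, k τ =
      ENNReal.ofReal (t ^ (α / N - 1)) * ∫⁻ τ in Ioo 0 t, rearr Ω g τ := by
    rw [restrict_Ioo_eq_restrict_Ioc, ← lintegral_const_mul _ measurable_rearr]
    exact setLIntegral_congr_fun measurableSet_Ioc fun τ hτ => by rw [← max_eq_left hτ.2]
  have hmiddle : ∫⁻ τ in Ioc t V, k τ =
      ∫⁻ τ in Ioo t V, ENNReal.ofReal (τ ^ (α / N - 1)) * rearr Ω g τ := by
    rw [restrict_Ioo_eq_restrict_Ioc]
    exact setLIntegral_congr_fun measurableSet_Ioc fun τ hτ => by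
      simp only [k, max_eq_right hτ.1.le]
  have hlarge : ∫⁻ τ in Ioi V, k τ = 0 := setLIntegral_eq_zero measurableSet_Ioi fun τ hτ => by
    have hΩτ := (ENNReal.lt_ofReal_iff_toReal_lt hΩ).2 hτ
    simp only [k, rearr_eq_zero hΩτ, mul_zero, Pi.zero_apply]
  calc oneilMajorant Ω α g t
      = ∫⁻ τ in Ioc 0 t ∪ (Ioc t V ∪ Ioi V), k τ := by
        rw [Ioc_union_Ioi_eq_Ioi ht.2.le, Ioc_union_Ioi_eq_Ioi ht.1.le, oneilMajorant]
    _ ≤ (∫⁻ τ in Ioc 0 t, k τ) + ((∫⁻ τ in Ioc t V, k τ) + ∫⁻ τ in Ioi V, k τ) :=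
        (lintegral_union_le _ _ _).trans (by gcongr; exact lintegral_union_le _ _ _)
    _ = _ := by rw [hsmall, hmiddle, hlarge, add_zero]

theorem logWeight_mul_oneilMajorant_le
    (hΩ : volume (Ω : Set (EuclideanSpace ℝ (Fin N))) ≠ ∞) (hα : α / N = 1 / 2)
    (g : EuclideanSpace ℝ (Fin N) → ℝ)
    (ht : t ∈ Ioo 0 (volume.real (Ω : Set (EuclideanSpace ℝ (Fin N))))) :
    ENNReal.ofReal (logWeight (volume.real (Ω : Set (EuclideanSpace ℝ (Fin N)))) t) *
        oneilMajorant Ω α g t ≤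
      (∫⁻ τ in Ioo 0 t, rearr Ω g τ) / ENNReal.ofReal t +
        ENNReal.ofReal (logWeight (volume.real (Ω : Set (EuclideanSpace ℝ (Fin N)))) t) *
          ∫⁻ τ in Ioo t (volume.real (Ω : Set (EuclideanSpace ℝ (Fin N)))),
            ENNReal.ofReal (τ ^ (-(1 / 2) : ℝ)) * rearr Ω g τ := by
  have hle := oneilMajorant_le hΩ α g ht
  rw [hα, show (1 / 2 - 1 : ℝ) = -(1 / 2) by norm_num] at hle
  refine (mul_le_mul_right hle _).trans ?_
  rw [mul_add, ← mul_assoc, ← ENNReal.ofReal_mul' (Real.rpow_nonneg ht.1.le _),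
    ENNReal.div_eq_inv_mul, ← ENNReal.ofReal_inv_of_pos ht.1]
  gcongr
  exact logWeight_mul_rpow_neg_half_le ht

theorem eLpNorm_logWeight_mul_oneilMajorant_le
    (hΩ : volume (Ω : Set (EuclideanSpace ℝ (Fin N))) ≠ ∞) (hα : α / N = 1 / 2)
    (hg : AEMeasurable g (volume.restrict Ω)) :
    eLpNorm (fun t =>
        ENNReal.ofReal (logWeight (volume.real (Ω : Set (EuclideanSpace ℝ (Fin N)))) t) *
          oneilMajorant Ω α g t) 2
      (volume.restrict (Ioo 0 (volume.real (Ω : Set (EuclideanSpace ℝ (Fin N)))))) ≤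
        4 * l2Norm Ω g := by
  set V := volume.real (Ω : Set (EuclideanSpace ℝ (Fin N)))
  have hV₀ : 0 ≤ V := measureReal_nonneg
  rcases hV₀.eq_or_lt' with hV | hV
  · simp [hV]
  set average : ℝ → ℝ≥0∞ := fun t => (∫⁻ τ in Ioo 0 t, rearr Ω g τ) / ENNReal.ofReal t
  set tail : ℝ → ℝ≥0∞ := fun t => ENNReal.ofReal (logWeight V t) *
    ∫⁻ τ in Ioo t V, ENNReal.ofReal (τ ^ (-(1 / 2) : ℝ)) * rearr Ω g τ
  have haverage : eLpNorm average 2 (volume.restrict (Ioi 0)) ≤ 2 * l2Norm Ω g :=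
    eLpNorm_rearr hg ▸
      eLpNorm_two_le_of_lintegral_sq_le (lintegral_sq_average_le measurable_rearr)
  have htail : eLpNorm tail 2 (volume.restrict (Ioo 0 V)) ≤ 2 * l2Norm Ω g :=
    (eLpNorm_logWeight_mul_tail_le hV measurable_rearr).trans <| by
      rw [← eLpNorm_rearr hg]
      gcongr
      exact Ioo_subset_Ioi_self
  have haverage_meas : Measurable average := Measurable.div
    (Monotone.measurable fun _ _ h => lintegral_mono_set (Ioo_subset_Ioo_right h)) (by fun_prop)
  have htail_meas : Measurable tail := (measurable_logWeight V).ennreal_ofReal.mul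
    (Antitone.measurable fun _ _ h => lintegral_mono_set (Ioo_subset_Ioo_left h))
  calc _ ≤ eLpNorm (average + tail) 2 (volume.restrict (Ioo 0 V)) :=
        eLpNorm_mono_enorm_ae (ae_restrict_of_forall_mem measurableSet_Ioo fun _ ht =>
          logWeight_mul_oneilMajorant_le hΩ hα g ht)
    _ ≤ eLpNorm average 2 (volume.restrict (Ioo 0 V)) +
          eLpNorm tail 2 (volume.restrict (Ioo 0 V)) :=
        eLpNorm_add_le haverage_meas.aestronglyMeasurable htail_meas.aestronglyMeasurable one_le_two
    _ ≤ 2 * l2Norm Ω g + 2 * l2Norm Ω g := by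
        gcongr
        exact (eLpNorm_mono_measure _ (Measure.restrict_mono_set _ Ioo_subset_Ioi_self)).trans
          haverage
    _ = 4 * l2Norm Ω g := by
        rw [← add_mul]
        norm_num

theorem lzQuasinorm_le_of_enorm_le_rieszPotential
    (hΩ : volume (Ω : Set (EuclideanSpace ℝ (Fin N))) ≠ ∞) (hα : 0 < α) (hαN : α / N = 1 / 2)
    (hf : Measurable f) (hg : Measurable g)
    (hfg : ∀ x ∈ Ω, ENNReal.ofReal (unitBallVolume N) * ‖f x‖ₑ ≤ rieszPotential Ω α g x) :
    lzQuasinorm Ω ∞ 2 (-1) f ≤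
      ENNReal.ofReal (8 / α * unitBallVolume N ^ (-(1 / 2) : ℝ)) * l2Norm Ω g := by
  have hω := unitBallVolume_pos N
  have hN : (N : ℝ) ≠ 0 := fun h => by simp [h] at hαN
  have hN2 : (N : ℝ) = 2 * α := by field_simp at hαN; linarith
  have hconst : (α⁻¹ + (N - α)⁻¹) * unitBallVolume N ^ (-(α / N)) =
      2 / α * unitBallVolume N ^ (-(1 / 2) : ℝ) := by
    rw [hαN, hN2]
    ring
  have hpoint {t : ℝ} (ht : 0 < t) : rearr Ω f t ≤
      ENNReal.ofReal (2 / α * unitBallVolume N ^ (-(1 / 2) : ℝ)) * oneilMajorant Ω α g t :=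
    hconst ▸ rearr_le_oneilMajorant hα (by linarith) hf hg hfg ht
  simp only [lzQuasinorm, lzWeight_top_two_neg_one]
  set V := volume.real (Ω : Set (EuclideanSpace ℝ (Fin N)))
  calc _ ≤ ENNReal.ofReal (2 / α * unitBallVolume N ^ (-(1 / 2) : ℝ)) *
        eLpNorm (fun t => ENNReal.ofReal (logWeight V t) * oneilMajorant Ω α g t) 2
          (volume.restrict (Ioo 0 V)) := by
        refine eLpNorm_le_mul_eLpNorm_of_ae_le_mul'
          (ae_restrict_of_forall_mem measurableSet_Ioo fun t ht => ?_) 2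
        simp only [enorm_eq_self]
        rw [mul_left_comm]
        exact mul_le_mul_right (hpoint ht.1) _
    _ ≤ ENNReal.ofReal (2 / α * unitBallVolume N ^ (-(1 / 2) : ℝ)) * (4 * l2Norm Ω g) := by
        gcongr
        exact eLpNorm_logWeight_mul_oneilMajorant_le hΩ hαN hg.aemeasurable
    _ = _ := by
        rw [← mul_assoc, ← ENNReal.ofReal_ofNat 4, ← ENNReal.ofReal_mul (by positivity)]
        ring_nf

end LorentzZygmundNorms

section TestFunctions

open LineDeriv

variable {E : Type*} [NormedAddCommGroup E] [NormedSpace ℝ E] {Ω : Opens E}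

theorem lineDerivOp_apply_eq_lineDeriv (φ : 𝓓(Ω, ℝ)) (v x : E) :
    (∂_{v} φ) x = lineDeriv ℝ φ x v :=
  TestFunction.lineDerivCLM_apply_of_le (𝕜 := ℝ) le_rfl

theorem differentiable_testFunction (φ : 𝓓(Ω, ℝ)) : Differentiable ℝ φ :=
  φ.contDiff.differentiable (by simp)

theorem lineDerivOp_apply_eq_fderiv (φ : 𝓓(Ω, ℝ)) (v x : E) : (∂_{v} φ) x = fderiv ℝ φ x v :=
  (lineDerivOp_apply_eq_lineDeriv φ v x).trans (differentiable_testFunction φ x).lineDeriv_eq_fderiv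

theorem lineDerivOp_comm (φ : 𝓓(Ω, ℝ)) (v w : E) : ∂_{v} (∂_{w} φ) = ∂_{w} (∂_{v} φ) := by
  have hsecond (v w x : E) : (∂_{v} (∂_{w} φ)) x = fderiv ℝ (fderiv ℝ φ) x v w := by
    have hd : DifferentiableAt ℝ (fderiv ℝ φ) x :=
      (φ.contDiff.fderiv_right (m := (1 : ℕ∞)) (by norm_cast)).differentiable (by simp) x
    rw [lineDerivOp_apply_eq_fderiv, funext (lineDerivOp_apply_eq_fderiv φ w),
      fderiv_clm_apply hd (differentiableAt_const w)]
    simp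
  ext x
  rw [hsecond, hsecond]
  exact φ.contDiff.contDiffAt.isSymmSndFDerivAt
    (by simpa using WithTop.coe_le_coe.2 (le_top (a := (2 : ℕ∞)))) _ _

theorem apply_eq_zero_of_notMem (φ : 𝓓(Ω, ℝ)) {x : E} (hx : x ∉ Ω) : φ x = 0 :=
  image_eq_zero_of_notMem_tsupport fun h => hx (φ.tsupport_subset h)

/-- Along a ray the function `r (∂_v φ)(x + r v) - φ (x + r v)` has derivative
`r (∂_v ∂_v φ)(x + r v)`. -/
theorem integral_ray_mul_lineDerivOp_lineDerivOp (φ : 𝓓(Ω, ℝ)) (x : E) {v : E} (hv : v ≠ 0) :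
    ∫ r in Ioi (0 : ℝ), r * (∂_{v} (∂_{v} φ)) (x + r • v) = φ x := by
  have hline (r : ℝ) : HasDerivAt (fun r : ℝ => x + r • v) v r := by
    simpa using ((hasDerivAt_id r).smul_const v).const_add x
  have hderiv (ψ : 𝓓(Ω, ℝ)) (r : ℝ) :
      HasDerivAt (fun r : ℝ => ψ (x + r • v)) ((∂_{v} ψ) (x + r • v)) r :=
    lineDerivOp_apply_eq_fderiv ψ v _ ▸
      (differentiable_testFunction ψ _).hasFDerivAt.comp_hasDerivAt r (hline r)
  have hcompact (ψ : 𝓓(Ω, ℝ)) : HasCompactSupport fun r : ℝ => ψ (x + r • v) :=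
    ψ.hasCompactSupport.comp_isClosedEmbedding
      ((Homeomorph.addLeft x).isClosedEmbedding.comp (isClosedEmbedding_smul_left hv))
  have hsmooth (ψ : 𝓓(Ω, ℝ)) : ContDiff ℝ 1 fun r : ℝ => ψ (x + r • v) :=
    (ψ.contDiff.of_le (by norm_cast)).comp (by fun_prop)
  have hF : ContDiff ℝ 1 fun r => r * (∂_{v} φ) (x + r • v) - φ (x + r • v) :=
    (contDiff_id.mul (hsmooth _)).sub (hsmooth φ)
  have hFderiv : deriv (fun r => r * (∂_{v} φ) (x + r • v) - φ (x + r • v)) =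
      fun r => r * (∂_{v} (∂_{v} φ)) (x + r • v) := funext fun r => by
    have h : HasDerivAt (fun r => r * (∂_{v} φ) (x + r • v) - φ (x + r • v)) _ r :=
      ((hasDerivAt_id r).mul (hderiv (∂_{v} φ) r)).sub (hderiv φ r)
    exact h.deriv.trans (by simp)
  rw [← hFderiv, HasCompactSupport.integral_Ioi_deriv_eq hF
    ((hcompact _).mul_left.sub (hcompact φ))]
  simp

variable [MeasurableSpace E] [BorelSpace E] {μ : Measure E}

theorem integrable_testFunction_mul [IsFiniteMeasureOnCompacts μ] (φ ψ : 𝓓(Ω, ℝ)) :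
    Integrable (fun x => φ x * ψ x) μ :=
  (φ.continuous.mul ψ.continuous).integrable_of_hasCompactSupport φ.hasCompactSupport.mul_right

variable [FiniteDimensional ℝ E] [μ.IsAddHaarMeasure]

theorem integral_mul_lineDerivOp (φ ψ : 𝓓(Ω, ℝ)) (v : E) :
    ∫ x, φ x * (∂_{v} ψ) x ∂μ = -∫ x, (∂_{v} φ) x * ψ x ∂μ := by
  have hφψ := integrable_testFunction_mul (μ := μ) (∂_{v} φ) ψ
  have hψφ := integrable_testFunction_mul (μ := μ) φ (∂_{v} ψ)
  simp only [lineDerivOp_apply_eq_fderiv] at hφψ hψφ ⊢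
  exact integral_mul_fderiv_eq_neg_fderiv_mul_of_integrable hφψ hψφ
    (integrable_testFunction_mul φ ψ) (fun x _ => differentiable_testFunction φ x)
    fun x _ => differentiable_testFunction ψ x

theorem integral_sq_lineDerivOp_lineDerivOp (φ : 𝓓(Ω, ℝ)) (v w : E) :
    ∫ x, (∂_{v} (∂_{w} φ) : 𝓓(Ω, ℝ)) x ^ 2 ∂μ =
      ∫ x, (∂_{v} (∂_{v} φ) : 𝓓(Ω, ℝ)) x * (∂_{w} (∂_{w} φ) : 𝓓(Ω, ℝ)) x ∂μ := by
  have hcomm : ∂_{v} (∂_{v} (∂_{w} φ)) = ∂_{w} (∂_{v} (∂_{v} φ)) := by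
    rw [lineDerivOp_comm φ v w, lineDerivOp_comm (∂_{v} φ) v w]
  simp only [sq]
  rw [integral_mul_lineDerivOp _ (∂_{w} φ) v, integral_mul_lineDerivOp _ (∂_{w} φ) w, hcomm]

theorem setLIntegral_unitBall_comp_add_smul {H : E → ℝ≥0∞} (hH : Measurable H) (x : E) {r : ℝ}
    (hr : 0 < r) : ∫⁻ v in Metric.ball 0 1, H (x + r • v) ∂μ =
      ENNReal.ofReal (r ^ (-Module.finrank ℝ E : ℝ)) * ∫⁻ y in Metric.ball x r, H y ∂μ := by
  have hF : Measurable ((Metric.ball x r).indicator H) := hH.indicator measurableSet_ball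
  calc ∫⁻ v in Metric.ball 0 1, H (x + r • v) ∂μ
      = ∫⁻ v, (fun w => (Metric.ball x r).indicator H (x + w)) (r • v) ∂μ := by
        rw [← lintegral_indicator measurableSet_ball]
        refine lintegral_congr fun v => ?_
        simp [indicator, norm_smul, abs_of_pos hr, mul_lt_iff_lt_one_right hr]
    _ = ∫⁻ w, (Metric.ball x r).indicator H (x + w) ∂(μ.map (r • ·)) := by
        rw [lintegral_map (by fun_prop) (by fun_prop)]
    _ = _ := by
        rw [Measure.map_addHaar_smul μ hr.ne', lintegral_smul_measure,
          lintegral_add_left_eq_self ((Metric.ball x r).indicator H),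
          lintegral_indicator measurableSet_ball, Real.rpow_neg hr.le, Real.rpow_natCast,
          abs_of_pos (by positivity), smul_eq_mul]

end TestFunctions

section Hessian

open Laplacian LineDeriv

variable {N : ℕ} {Ω : Opens (EuclideanSpace ℝ (Fin N))}

/-- The Laplacian of a test function, which makes the notation `Δ φ` available. -/
noncomputable instance : Laplacian 𝓓(Ω, ℝ) 𝓓(Ω, ℝ) where
  laplacian := laplacianCLM ℝ (EuclideanSpace ℝ (Fin N)) 𝓓(Ω, ℝ)

/-- The entry `∂ᵢ∂ⱼφ` of the Hessian matrix of a test function. -/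
noncomputable def hessianEntry (φ : 𝓓(Ω, ℝ)) (i j : Fin N) : 𝓓(Ω, ℝ) :=
  ∂_{EuclideanSpace.single i (1 : ℝ)} (∂_{EuclideanSpace.single j (1 : ℝ)} φ)

/-- The Hilbert–Schmidt norm of the Hessian of a test function. -/
noncomputable def hessianNorm (φ : 𝓓(Ω, ℝ)) (x : EuclideanSpace ℝ (Fin N)) : ℝ :=
  √(∑ i, ∑ j, hessianEntry φ i j x ^ 2)

theorem continuous_hessianNorm (φ : 𝓓(Ω, ℝ)) : Continuous (hessianNorm φ) :=
  Real.continuous_sqrt.comp <| continuous_finsetSum _ fun _ _ => continuous_finsetSum _ fun _ _ =>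
    (TestFunction.continuous _).pow 2

theorem hessianNorm_nonneg (φ : 𝓓(Ω, ℝ)) (x : EuclideanSpace ℝ (Fin N)) : 0 ≤ hessianNorm φ x :=
  Real.sqrt_nonneg _

theorem hessianNorm_sq (φ : 𝓓(Ω, ℝ)) (x : EuclideanSpace ℝ (Fin N)) :
    hessianNorm φ x ^ 2 = ∑ i, ∑ j, hessianEntry φ i j x ^ 2 :=
  Real.sq_sqrt (by positivity)

theorem hessianNorm_eq_zero_of_notMem (φ : 𝓓(Ω, ℝ)) {x : EuclideanSpace ℝ (Fin N)} (hx : x ∉ Ω) :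
    hessianNorm φ x = 0 := by
  simp [hessianNorm, apply_eq_zero_of_notMem _ hx]

theorem laplacian_apply_eq_sum (φ : 𝓓(Ω, ℝ)) (x : EuclideanSpace ℝ (Fin N)) :
    Δ φ x = ∑ i, hessianEntry φ i i x := by
  change laplacianCLM ℝ (EuclideanSpace ℝ (Fin N)) 𝓓(Ω, ℝ) φ x = _
  rw [laplacianCLM_eq_sum (EuclideanSpace.basisFun (Fin N) ℝ)]
  simp [hessianEntry]

theorem lineDerivOp_lineDerivOp_apply_eq_sum (φ : 𝓓(Ω, ℝ)) (v x : EuclideanSpace ℝ (Fin N)) :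
    (∂_{v} (∂_{v} φ) : 𝓓(Ω, ℝ)) x = ∑ i, ∑ j, v i * v j * hessianEntry φ i j x := by
  have hv : v = ∑ i, v i • EuclideanSpace.single i (1 : ℝ) := by
    simpa using ((EuclideanSpace.basisFun (Fin N) ℝ).sum_repr v).symm
  have hexpand (ψ : 𝓓(Ω, ℝ)) :
      ∂_{v} ψ = ∑ i, v i • ∂_{EuclideanSpace.single i (1 : ℝ)} ψ := by
    conv_lhs => rw [hv, lineDerivOp_left_sum]
    simp only [lineDerivOp_left_smul]
  rw [hexpand (∂_{v} φ), hexpand φ]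
  simp [hessianEntry, lineDerivOp_sum, lineDerivOp_smul, Finset.mul_sum, mul_assoc]

theorem abs_lineDerivOp_lineDerivOp_le (φ : 𝓓(Ω, ℝ)) (v x : EuclideanSpace ℝ (Fin N)) :
    |(∂_{v} (∂_{v} φ) : 𝓓(Ω, ℝ)) x| ≤ hessianNorm φ x * ‖v‖ ^ 2 := by
  have hnorm : ∑ p : Fin N × Fin N, (v p.1 * v p.2) ^ 2 = (‖v‖ ^ 2) ^ 2 := by
    rw [EuclideanSpace.real_norm_sq_eq, sq (∑ _, _), Finset.sum_mul_sum, Fintype.sum_prod_type]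
    simp only [mul_pow]
  refine abs_le_of_sq_le_sq ?_ (mul_nonneg (hessianNorm_nonneg φ x) (by positivity))
  rw [lineDerivOp_lineDerivOp_apply_eq_sum, mul_pow, hessianNorm_sq, ← hnorm, mul_comm]
  simp only [← Fintype.sum_prod_type']
  exact Finset.sum_mul_sq_le_sq_mul_sq _ _ _

theorem integrable_hessianEntry_mul (φ : 𝓓(Ω, ℝ)) (i j k l : Fin N) :
    Integrable fun x => hessianEntry φ i j x * hessianEntry φ k l x :=
  integrable_testFunction_mul _ _

theorem integrable_hessianNorm_sq (φ : 𝓓(Ω, ℝ)) : Integrable fun x => hessianNorm φ x ^ 2 := by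
  simp only [hessianNorm_sq]
  simp only [sq]
  exact integrable_finsetSum _ fun i _ => integrable_finsetSum _ fun j _ =>
    integrable_hessianEntry_mul φ i j i j

theorem integral_hessianNorm_sq (φ : 𝓓(Ω, ℝ)) :
    ∫ x, hessianNorm φ x ^ 2 = ∫ x, Δ φ x ^ 2 := by
  have hint := integrable_hessianEntry_mul φ
  have hsq (i j : Fin N) : Integrable fun x => hessianEntry φ i j x ^ 2 := by
    simpa only [sq] using hint i j i j
  simp only [hessianNorm_sq, laplacian_apply_eq_sum, sq (∑ _, _), Finset.sum_mul_sum]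
  rw [integral_finsetSum _ fun i _ => integrable_finsetSum _ fun j _ => hsq i j,
    integral_finsetSum _ fun i _ => integrable_finsetSum _ fun j _ => hint i i j j]
  refine Finset.sum_congr rfl fun i _ => ?_
  rw [integral_finsetSum _ fun j _ => hsq i j, integral_finsetSum _ fun j _ => hint i i j j]
  exact Finset.sum_congr rfl fun j _ => integral_sq_lineDerivOp_lineDerivOp φ _ _

theorem l2Norm_eq_ofReal_integral_sq {f : EuclideanSpace ℝ (Fin N) → ℝ}
    (hf : Integrable fun x => f x ^ 2) (hf₀ : ∀ x ∉ Ω, f x = 0) :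
    l2Norm Ω f = ENNReal.ofReal (∫ x, f x ^ 2) ^ (1 / 2 : ℝ) := by
  have hsq (x : EuclideanSpace ℝ (Fin N)) : ‖f x‖ₑ ^ 2 = ENNReal.ofReal (f x ^ 2) := by
    rw [← enorm_pow, Real.enorm_of_nonneg (sq_nonneg _)]
  rw [l2Norm, ← eLpNorm_enorm, eLpNorm_two_eq, ← setIntegral_eq_integral_of_forall_compl_eq_zero
    (s := Ω) fun x hx => by rw [hf₀ x hx, zero_pow two_ne_zero],
    ofReal_integral_eq_lintegral_ofReal hf.integrableOn (.of_forall fun x => sq_nonneg _)]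
  simp only [hsq]

theorem l2Norm_hessianNorm (φ : 𝓓(Ω, ℝ)) :
    l2Norm Ω (hessianNorm φ) = l2Norm Ω (Δ φ : 𝓓(Ω, ℝ)) := by
  rw [l2Norm_eq_ofReal_integral_sq (integrable_hessianNorm_sq φ) fun x =>
      hessianNorm_eq_zero_of_notMem φ,
    l2Norm_eq_ofReal_integral_sq (by simpa only [sq] using integrable_testFunction_mul _ _)
      fun x => apply_eq_zero_of_notMem _, integral_hessianNorm_sq]

theorem enorm_le_lintegral_ray_hessianNorm (φ : 𝓓(Ω, ℝ)) (x : EuclideanSpace ℝ (Fin N))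
    {v : EuclideanSpace ℝ (Fin N)} (hv₀ : v ≠ 0) (hv : ‖v‖ ≤ 1) :
    ‖φ x‖ₑ ≤ ∫⁻ r in Ioi (0 : ℝ), ENNReal.ofReal r * ‖hessianNorm φ (x + r • v)‖ₑ := by
  rw [← integral_ray_mul_lineDerivOp_lineDerivOp φ x hv₀]
  refine (enorm_integral_le_lintegral_enorm _).trans
    (setLIntegral_mono' measurableSet_Ioi fun r hr => ?_)
  rw [enorm_mul, Real.enorm_of_nonneg (mem_Ioi.1 hr).le]
  gcongr
  rw [enorm_le_iff_norm_le, Real.norm_eq_abs, Real.norm_of_nonneg (hessianNorm_nonneg φ _)]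
  exact (abs_lineDerivOp_lineDerivOp_le φ v _).trans
    (mul_le_of_le_one_right (hessianNorm_nonneg φ _) (pow_le_one₀ (norm_nonneg v) hv))

theorem ofReal_unitBallVolume_mul_enorm_le_rieszPotential [NeZero N] (φ : 𝓓(Ω, ℝ))
    (x : EuclideanSpace ℝ (Fin N)) :
    ENNReal.ofReal (unitBallVolume N) * ‖φ x‖ₑ ≤ rieszPotential Ω 2 (hessianNorm φ) x := by
  have hmeas : Measurable (hessianNorm φ) := (continuous_hessianNorm φ).measurable
  calc ENNReal.ofReal (unitBallVolume N) * ‖φ x‖ₑ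
      = ∫⁻ _ in Metric.ball (0 : EuclideanSpace ℝ (Fin N)) 1, ‖φ x‖ₑ := by
        rw [setLIntegral_const, unitBallVolume, ofReal_measureReal measure_ball_lt_top.ne, mul_comm]
    _ ≤ ∫⁻ v in Metric.ball (0 : EuclideanSpace ℝ (Fin N)) 1, ∫⁻ r in Ioi (0 : ℝ),
          ENNReal.ofReal r * ‖hessianNorm φ (x + r • v)‖ₑ := by
        refine lintegral_mono_ae ?_
        filter_upwards [ae_restrict_mem measurableSet_ball,
          ae_restrict_of_ae (Measure.ae_ne volume 0)] with v hv hv₀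
        exact enorm_le_lintegral_ray_hessianNorm φ x hv₀ (mem_ball_zero_iff.1 hv).le
    _ = ∫⁻ r in Ioi (0 : ℝ), ∫⁻ v in Metric.ball (0 : EuclideanSpace ℝ (Fin N)) 1,
          ENNReal.ofReal r * ‖hessianNorm φ (x + r • v)‖ₑ :=
        lintegral_lintegral_swap (Measurable.aemeasurable (by fun_prop))
    _ = rieszPotential Ω 2 (hessianNorm φ) x := by
        refine setLIntegral_congr_fun measurableSet_Ioi fun r (hr : 0 < r) => ?_
        have hball : ∫⁻ y in Metric.ball x r, ‖hessianNorm φ y‖ₑ =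
            ∫⁻ y in Metric.ball x r ∩ Ω, ‖hessianNorm φ y‖ₑ := by
          rw [inter_comm, ← setLIntegral_indicator Ω.isOpen.measurableSet, indicator_eq_self.2]
          exact fun y => not_imp_comm.1 fun hy => by simp [hessianNorm_eq_zero_of_notMem φ hy]
        have hpow : r * r ^ (-N : ℝ) = r ^ (2 - N - 1 : ℝ) := by
          rw [mul_comm, ← Real.rpow_add_one hr.ne']
          ring_nf
        beta_reduce
        rw [lintegral_const_mul' _ _ ENNReal.ofReal_ne_top,
          setLIntegral_unitBall_comp_add_smul hmeas.enorm x hr, ← mul_assoc,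
          ← ENNReal.ofReal_mul hr.le, finrank_euclideanSpace_fin, hpow, hball]

end Hessian

section WeakDerivatives

open Laplacian LineDeriv

variable {N : ℕ} {Ω : Opens (EuclideanSpace ℝ (Fin N))}
  {u u' v v' w : EuclideanSpace ℝ (Fin N) → ℝ} {i j : Fin N}

theorem integrableOn_mul_testFunction (hu : LocallyIntegrableOn u (Ω : Set _)) (φ : 𝓓(Ω, ℝ)) :
    IntegrableOn (fun x => u x * φ x) (Ω : Set _) :=
  (TestFunction.integrable_bilin (ContinuousLinearMap.mul ℝ ℝ).flip hu φ).integrableOn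

theorem isWeakPartial_iff : IsWeakPartial Ω i u v ↔
    LocallyIntegrableOn u (Ω : Set _) ∧ LocallyIntegrableOn v (Ω : Set _) ∧
    ∀ φ : 𝓓(Ω, ℝ), ∫ x in (Ω : Set _), u x * (∂_{EuclideanSpace.single i (1 : ℝ)} φ) x =
      -∫ x in (Ω : Set _), v x * φ x := by
  simp only [IsWeakPartial, lineDerivOp_apply_eq_lineDeriv]

theorem IsWeakPartial.ae_unique (h : IsWeakPartial Ω i u v) (h' : IsWeakPartial Ω i u v') :
    v =ᵐ[volume.restrict (Ω : Set _)] v' := by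
  have horthogonal (g : EuclideanSpace ℝ (Fin N) → ℝ) (hg : ContDiff ℝ (⊤ : ℕ∞) g)
      (hgc : HasCompactSupport g) (hgs : tsupport g ⊆ Ω) : ∫ x, g x • (v - v') x = 0 := by
    let φ : 𝓓(Ω, ℝ) := ⟨g, hg, hgc, hgs⟩
    have heq : ∫ x in (Ω : Set _), v x * φ x = ∫ x in (Ω : Set _), v' x * φ x :=
      neg_injective ((h.2.2 φ).symm.trans (h'.2.2 φ))
    calc ∫ x, g x • (v - v') x
        = ∫ x in (Ω : Set _), φ x • (v - v') x :=
          (setIntegral_eq_integral_of_forall_compl_eq_zero fun x hx => by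
            rw [show g x = 0 from apply_eq_zero_of_notMem φ hx, zero_smul]).symm
      _ = ∫ x in (Ω : Set _), (v x * φ x - v' x * φ x) := by
          simp only [Pi.sub_apply, smul_eq_mul, mul_comm (φ _), sub_mul]
      _ = 0 := by
          rw [integral_sub (integrableOn_mul_testFunction h.2.1 φ)
            (integrableOn_mul_testFunction h'.2.1 φ), heq, sub_self]
  rw [EventuallyEq, ae_restrict_iff' Ω.isOpen.measurableSet]
  filter_upwards [Ω.isOpen.ae_eq_zero_of_integral_contDiff_smul_eq_zero (h.2.1.sub h'.2.1)
    horthogonal] with x hx hxΩ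
  exact sub_eq_zero.1 (hx hxΩ)

theorem IsWeakPartial.congr_left (h : IsWeakPartial Ω i u v)
    (hu : u =ᵐ[volume.restrict (Ω : Set _)] u') (hu' : LocallyIntegrableOn u' (Ω : Set _)) :
    IsWeakPartial Ω i u' v := by
  refine ⟨hu', h.2.1, fun φ => ?_⟩
  rw [← h.2.2 φ]
  refine integral_congr_ae ?_
  filter_upwards [hu] with x hx
  rw [hx]

theorem IsWeakPartial.sub (h : IsWeakPartial Ω i u v) (h' : IsWeakPartial Ω i u' v') :
    IsWeakPartial Ω i (fun x => u x - u' x) (fun x => v x - v' x) := by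
  rw [isWeakPartial_iff] at h h' ⊢
  refine ⟨h.1.sub h'.1, h.2.1.sub h'.2.1, fun φ => ?_⟩
  simp only [sub_mul]
  rw [integral_sub (integrableOn_mul_testFunction h.1 _) (integrableOn_mul_testFunction h'.1 _),
    integral_sub (integrableOn_mul_testFunction h.2.1 φ) (integrableOn_mul_testFunction h'.2.1 φ),
    h.2.2 φ, h'.2.2 φ]
  ring

theorem isWeakPartial_testFunction (φ : 𝓓(Ω, ℝ)) (i : Fin N) :
    IsWeakPartial Ω i φ (∂_{EuclideanSpace.single i (1 : ℝ)} φ : 𝓓(Ω, ℝ)) := by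
  refine isWeakPartial_iff.2 ⟨φ.continuous.locallyIntegrable.locallyIntegrableOn _,
    (TestFunction.continuous _).locallyIntegrable.locallyIntegrableOn _, fun ψ => ?_⟩
  rw [setIntegral_eq_integral_of_forall_compl_eq_zero fun x hx => by
      rw [apply_eq_zero_of_notMem φ hx, zero_mul],
    setIntegral_eq_integral_of_forall_compl_eq_zero fun x hx => by
      rw [apply_eq_zero_of_notMem ψ hx, mul_zero]]
  exact integral_mul_lineDerivOp φ ψ _

theorem isWeakPartial_weakPartial (h : ∃ v, IsWeakPartial Ω i u v) :
    IsWeakPartial Ω i u (weakPartial Ω i u) := by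
  rw [weakPartial, dif_pos h]
  exact h.choose_spec

theorem IsWeakPartial.weakPartial_ae_eq (h : IsWeakPartial Ω i u v) :
    weakPartial Ω i u =ᵐ[volume.restrict (Ω : Set _)] v :=
  (isWeakPartial_weakPartial ⟨v, h⟩).ae_unique h

theorem IsWeakPartial.isWeakPartial_weakPartial (h : IsWeakPartial Ω i u v)
    (h' : IsWeakPartial Ω j v w) : IsWeakPartial Ω j (weakPartial Ω i u) w :=
  h'.congr_left h.weakPartial_ae_eq.symm (LorentzZygmund.isWeakPartial_weakPartial ⟨v, h⟩).2.1

theorem weakLaplacian_ae_eq_sum {w : Fin N → EuclideanSpace ℝ (Fin N) → ℝ}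
    (h : ∀ i, IsWeakPartial Ω i (weakPartial Ω i u) (w i)) :
    weakLaplacian Ω u =ᵐ[volume.restrict (Ω : Set _)] fun x => ∑ i, w i x := by
  filter_upwards [ae_all_iff.2 fun i => (h i).weakPartial_ae_eq] with x hx
  simp only [weakLaplacian, hx]

theorem MemH2.isWeakPartial_weakPartial_sub (hu : MemH2 Ω u) (φ : 𝓓(Ω, ℝ)) (i j : Fin N) :
    IsWeakPartial Ω j (weakPartial Ω i fun x => u x - φ x)
      (fun x => weakPartial Ω j (weakPartial Ω i u) x - hessianEntry φ j i x) :=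
  ((isWeakPartial_weakPartial (hu.exists_first i)).sub
    (isWeakPartial_testFunction φ i)).isWeakPartial_weakPartial <|
      (isWeakPartial_weakPartial (hu.exists_second i j)).sub (isWeakPartial_testFunction _ j)

theorem MemH2.weakLaplacian_sub (hu : MemH2 Ω u) (φ : 𝓓(Ω, ℝ)) :
    weakLaplacian Ω (fun x => u x - φ x) =ᵐ[volume.restrict (Ω : Set _)]
      fun x => weakLaplacian Ω u x - Δ φ x := by
  refine (weakLaplacian_ae_eq_sum fun i => hu.isWeakPartial_weakPartial_sub φ i i).trans
    (.of_eq <| funext fun x => ?_)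
  rw [Finset.sum_sub_distrib, laplacian_apply_eq_sum, weakLaplacian]

theorem MemH2.memLp_weakLaplacian (hu : MemH2 Ω u) :
    MemLp (weakLaplacian Ω u) 2 (volume.restrict (Ω : Set _)) :=
  memLp_finsetSum _ fun i _ => hu.memLp_second i i

theorem le_h2Norm_of_sq_le {a : ℝ≥0∞}
    (h : a ^ 2 ≤ l2Norm Ω u ^ 2 + ∑ i, l2Norm Ω (weakPartial Ω i u) ^ 2 +
      ∑ i, ∑ j, l2Norm Ω (weakPartial Ω j (weakPartial Ω i u)) ^ 2) : a ≤ h2Norm Ω u := by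
  rw [h2Norm, one_div, ENNReal.le_rpow_inv_iff two_pos, ENNReal.rpow_two]
  exact h

theorem l2Norm_le_h2Norm : l2Norm Ω u ≤ h2Norm Ω u :=
  le_h2Norm_of_sq_le (by rw [add_assoc]; exact le_self_add)

theorem l2Norm_weakPartial_weakPartial_le_h2Norm (i j : Fin N) :
    l2Norm Ω (weakPartial Ω j (weakPartial Ω i u)) ≤ h2Norm Ω u := by
  refine le_h2Norm_of_sq_le (le_trans ?_ le_add_self)
  calc l2Norm Ω (weakPartial Ω j (weakPartial Ω i u)) ^ 2
      ≤ ∑ j, l2Norm Ω (weakPartial Ω j (weakPartial Ω i u)) ^ 2 :=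
        Finset.single_le_sum (f := fun j => l2Norm Ω (weakPartial Ω j (weakPartial Ω i u)) ^ 2)
          (fun _ _ => zero_le) (Finset.mem_univ j)
    _ ≤ ∑ i, ∑ j, l2Norm Ω (weakPartial Ω j (weakPartial Ω i u)) ^ 2 :=
        Finset.single_le_sum
          (f := fun i => ∑ j, l2Norm Ω (weakPartial Ω j (weakPartial Ω i u)) ^ 2)
          (fun _ _ => zero_le) (Finset.mem_univ i)

theorem l2Norm_weakLaplacian_le_h2Norm (h : ∀ i, ∃ v, IsWeakPartial Ω i (weakPartial Ω i u) v) :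
    l2Norm Ω (weakLaplacian Ω u) ≤ N * h2Norm Ω u := by
  have hsum : weakLaplacian Ω u = ∑ i, weakPartial Ω i (weakPartial Ω i u) := by
    ext x
    simp [weakLaplacian]
  calc l2Norm Ω (weakLaplacian Ω u) ≤ ∑ i, l2Norm Ω (weakPartial Ω i (weakPartial Ω i u)) := by
        rw [hsum]
        exact eLpNorm_sum_le
          (fun i _ => (isWeakPartial_weakPartial (h i)).2.1.aestronglyMeasurable) one_le_two
    _ ≤ ∑ _i : Fin N, h2Norm Ω u :=
        Finset.sum_le_sum fun i _ => l2Norm_weakPartial_weakPartial_le_h2Norm i i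
    _ = N * h2Norm Ω u := by simp

theorem MemH2.l2Norm_laplacian_le (hu : MemH2 Ω u) (φ : 𝓓(Ω, ℝ)) :
    l2Norm Ω (Δ φ : 𝓓(Ω, ℝ)) ≤
      l2Norm Ω (weakLaplacian Ω u) + N * h2Norm Ω (fun x => u x - φ x) := by
  have hmeas := hu.memLp_weakLaplacian.aestronglyMeasurable
  have hsub := hu.weakLaplacian_sub φ
  have heq : (Δ φ : 𝓓(Ω, ℝ)) =ᵐ[volume.restrict (Ω : Set _)]
      weakLaplacian Ω u - weakLaplacian Ω (fun x => u x - φ x) := by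
    filter_upwards [hsub] with x hx
    rw [Pi.sub_apply, hx, sub_sub_cancel]
  calc l2Norm Ω (Δ φ : 𝓓(Ω, ℝ))
      ≤ l2Norm Ω (weakLaplacian Ω u) + l2Norm Ω (weakLaplacian Ω (fun x => u x - φ x)) := by
        rw [l2Norm, eLpNorm_congr_ae heq]
        refine eLpNorm_sub_le hmeas (.congr ?_ hsub.symm) one_le_two
        exact hmeas.sub (TestFunction.continuous _).aestronglyMeasurable
    _ ≤ l2Norm Ω (weakLaplacian Ω u) + N * h2Norm Ω (fun x => u x - φ x) := by
        gcongr
        exact l2Norm_weakLaplacian_le_h2Norm fun i => ⟨_, hu.isWeakPartial_weakPartial_sub φ i i⟩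

theorem MemH20.exists_tendsto_h2Norm_sub (hu : MemH20 Ω u) :
    ∃ φ : ℕ → 𝓓(Ω, ℝ), Tendsto (fun n => h2Norm Ω fun x => u x - φ n x) atTop (𝓝 0) := by
  obtain ⟨ε, -, hε, hε₀⟩ := exists_seq_strictAnti_tendsto' (zero_lt_one (α := ℝ≥0∞))
  choose φ hφ using fun n => hu.2 (ε n) (hε n).1
  exact ⟨φ, tendsto_of_tendsto_of_tendsto_of_le_of_le tendsto_const_nhds hε₀
    (fun _ => zero_le) fun n => (hφ n).le⟩

end WeakDerivatives

section Embedding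

open Laplacian

variable {Ω : Opens (EuclideanSpace ℝ (Fin 4))}

/-- The constant in the embedding inequality for the quasinorm; it depends only on the
dimension. -/
noncomputable def embeddingConst : ℝ≥0 := 4 * (unitBallVolume 4 ^ (-(1 / 2) : ℝ)).toNNReal

theorem lzQuasinorm_testFunction_le (hΩ : volume (Ω : Set (EuclideanSpace ℝ (Fin 4))) ≠ ∞)
    (φ : 𝓓(Ω, ℝ)) : lzQuasinorm Ω ∞ 2 (-1) φ ≤ embeddingConst * l2Norm Ω (Δ φ : 𝓓(Ω, ℝ)) := by
  have h := lzQuasinorm_le_of_enorm_le_rieszPotential hΩ two_pos (by norm_num)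
    φ.continuous.measurable (continuous_hessianNorm φ).measurable
    fun x _ => ofReal_unitBallVolume_mul_enorm_le_rieszPotential φ x
  rw [l2Norm_hessianNorm] at h
  norm_num at h
  exact h

theorem MemH20.lzQuasinorm_le {u : EuclideanSpace ℝ (Fin 4) → ℝ} (hu : MemH20 Ω u)
    (hΩ : volume (Ω : Set (EuclideanSpace ℝ (Fin 4))) ≠ ∞) :
    lzQuasinorm Ω ∞ 2 (-1) u ≤ embeddingConst * l2Norm Ω (weakLaplacian Ω u) := by
  obtain ⟨φ, hφ⟩ := hu.exists_tendsto_h2Norm_sub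
  have hl2 : Tendsto (fun n => l2Norm Ω fun x => u x - φ n x) atTop (𝓝 0) :=
    tendsto_of_tendsto_of_tendsto_of_le_of_le tendsto_const_nhds hφ (fun _ => zero_le)
      fun _ => l2Norm_le_h2Norm
  have hbound : Tendsto (fun n => embeddingConst * (l2Norm Ω (weakLaplacian Ω u) +
      (4 : ℕ) * h2Norm Ω fun x => u x - φ n x)) atTop
      (𝓝 (embeddingConst * l2Norm Ω (weakLaplacian Ω u))) := by
    have h := ENNReal.Tendsto.const_mul (a := embeddingConst) ((ENNReal.Tendsto.const_mul hφ
      (.inr (ENNReal.natCast_ne_top 4))).const_add (l2Norm Ω (weakLaplacian Ω u)))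
      (.inr ENNReal.coe_ne_top)
    simpa using h
  calc lzQuasinorm Ω ∞ 2 (-1) u
      ≤ liminf (fun n => lzQuasinorm Ω ∞ 2 (-1) (φ n)) atTop :=
        lzQuasinorm_le_liminf two_ne_zero ENNReal.ofNat_ne_top (-1)
          (fun n => hu.1.memLp.aemeasurable.sub (φ n).continuous.aemeasurable) hl2
    _ ≤ liminf (fun n => embeddingConst * (l2Norm Ω (weakLaplacian Ω u) +
          (4 : ℕ) * h2Norm Ω fun x => u x - φ n x)) atTop :=
        liminf_le_liminf (.of_forall fun n => (lzQuasinorm_testFunction_le hΩ (φ n)).trans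
          (mul_right_mono (hu.1.l2Norm_laplacian_le (φ n))))
    _ = embeddingConst * l2Norm Ω (weakLaplacian Ω u) := hbound.liminf_eq

end Embedding

end LorentzZygmund

theorem mainTheorem6_general :
    ∃ C : ℝ≥0, ∀ Ω : Opens (EuclideanSpace ℝ (Fin 4)),
      volume (Ω : Set (EuclideanSpace ℝ (Fin 4))) ≠ ∞ →
      ∀ u : EuclideanSpace ℝ (Fin 4) → ℝ, LorentzZygmund.MemH20 Ω u →
      LorentzZygmund.MemLorentzZygmund Ω ∞ 2 (-1) u ∧
      LorentzZygmund.lzQuasinorm Ω ∞ 2 (-1) u ≤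
        C * LorentzZygmund.l2Norm Ω (LorentzZygmund.weakLaplacian Ω u) ∧
      LorentzZygmund.lzNorm Ω ∞ 2 (-1) u ≤
        C * LorentzZygmund.l2Norm Ω (LorentzZygmund.weakLaplacian Ω u) ∧
      LorentzZygmund.lzNorm Ω ∞ 2 (-1) u ≤ C * LorentzZygmund.h2Norm Ω u := by
  open LorentzZygmund in
  refine ⟨16 * embeddingConst, fun Ω hΩ u hu => ?_⟩
  have hquasi := hu.lzQuasinorm_le hΩ
  have hnorm : lzNorm Ω ∞ 2 (-1) u ≤ 4 * (embeddingConst * l2Norm Ω (weakLaplacian Ω u)) :=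
    (lzNorm_le_lzQuasinorm Ω u).trans (by gcongr)
  have hlaplacian : l2Norm Ω (weakLaplacian Ω u) ≤ (4 : ℕ) * h2Norm Ω u :=
    l2Norm_weakLaplacian_le_h2Norm fun i => hu.1.exists_second i i
  have hquasi_finite : lzQuasinorm Ω ∞ 2 (-1) u < ∞ :=
    hquasi.trans_lt (ENNReal.mul_lt_top ENNReal.coe_lt_top hu.1.memLp_weakLaplacian.2)
  refine ⟨⟨hu.1.memLp.1.aemeasurable, hquasi_finite⟩, hquasi.trans ?_, hnorm.trans ?_,
    hnorm.trans ?_⟩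
  · gcongr
    exact_mod_cast le_mul_of_one_le_left' (by norm_num)
  · rw [← mul_assoc, ENNReal.coe_mul]
    gcongr
    norm_num
  · calc 4 * (embeddingConst * l2Norm Ω (weakLaplacian Ω u))
        ≤ 4 * (embeddingConst * ((4 : ℕ) * h2Norm Ω u)) := by gcongr
      _ = (16 * embeddingConst : ℝ≥0) * h2Norm Ω u := by
          push_cast
          ring

theorem mainTheorem6 (Ω : TopologicalSpace.Opens (EuclideanSpace ℝ (Fin 4)))
    (hΩ : Bornology.IsBounded (Ω : Set (EuclideanSpace ℝ (Fin 4)))) :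
    ∃ C : ℝ≥0, ∀ u : EuclideanSpace ℝ (Fin 4) → ℝ, LorentzZygmund.MemH20 Ω u →
      LorentzZygmund.MemLorentzZygmund Ω ∞ 2 (-1) u ∧
      LorentzZygmund.lzQuasinorm Ω ∞ 2 (-1) u ≤
        C * LorentzZygmund.l2Norm Ω (LorentzZygmund.weakLaplacian Ω u) ∧
      LorentzZygmund.lzNorm Ω ∞ 2 (-1) u ≤
        C * LorentzZygmund.l2Norm Ω (LorentzZygmund.weakLaplacian Ω u) ∧
      LorentzZygmund.lzNorm Ω ∞ 2 (-1) u ≤ C * LorentzZygmund.h2Norm Ω u :=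
  let ⟨C, hC⟩ := mainTheorem6_general
  ⟨C, hC Ω hΩ.measure_lt_top.ne⟩
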